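/- **Setting.** Let $K$ be a compact connected metric space and let $F_0,\dots,F_{N-1}:K\to K$ ($N\ge 4$) be injective contractions with $K=\bigcup_l F_lK$. Put $F_w=F_{w_1}\circ\cdots\circ F_{w_m}$ for a word $w=w_1\cdots w_m$ of length $|w|=m$. Let $V_0=\{q_0,q_1,q_2,q_3\}$ consist of four distinct points with $F_lq_l=q_l$ $(0\le l<4)$, and assume that for distinct words $w\neq w'$ of the same length $F_wK\cap F_{w'}K\subset (F_wV_0\cap F_{w'}V_0)\setminus V_0$ (p.c.f. condition). Let $V_m=\bigcup_{|w|=m}F_wV_0$ and $V_*=\bigcup_m V_m$; write $x\sim_m y$ if $x=F_wq_i$, $y=F_wq_j$ for some $|w|=m$ and $i\ne j$. Let $E_0(u)=\sum_{i<j}(u(q_i)-u(q_j))^2$, let $0<r_l<1$ $(0\le l<N)$, $r_w=r_{w_1}\cdots r_{w_m}$, and $E_m(u)=\sum_{|w|=m}r_w^{-1}E_0(u\circ F_w)$. Assume that for all values given on $V_0$ the minimum of $E_1$ over all extensions equals $E_0$ (regular harmonic structure), and put $E(u)=\lim_m E_m(u)\in[0,\infty]$. Let $\mu_l>0$, $\sum_l\mu_l=1$,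 $\mu_w=\mu_{w_1}\cdots\mu_{w_m}$, and let $\mu$ be a Borel probability measure with $\mu(A)=\sum_l\mu_l\,\mu(F_l^{-1}A)$. Assume $r_0=r_1=r_2=r_3=:r$ and $r_l\mu_l=\rho$ for all $0\le l<N$. Assume full ("$D4$") symmetry: every permutation of $V_0$ is induced by a homeomorphism of $K$ that leaves $E$ (on continuous functions) and $\mu$ invariant. The harmonic extension matrices may be degenerate. For $x\in V_m\setminus V_0$ let $\Delta_m u(x)=\sum_{y\sim_m x}c_{xy}(u(y)-u(x))$, where $c_{xy}$ is the sum of $r_w^{-1}$ over the words $w$ of length $m$ for which $\{x,y\}\subset F_wV_0$, and $\tilde\Delta_m u(x)=\big(\int\psi_x^m\,d\mu\big)^{-1}\Delta_m u(x)$, where $\psi_x^m$ is the tent function: continuous, harmonic on each cell of level $m$, equal to $1$ at $x$ and to $0$ on $V_m\setminus\{x\}$. (A continuous function is harmonic if, for every $m$, it minimizes $E_{m+1}$ among all functions with the same values on $V_m$.) Write $\Delta u=f$ if $u,f$ are continuous on $K$ and $\tilde\Delta_m u\to f$ uniformly on $V_*\setminus V_0$, that is, $\sup_{x\in V_m\setminus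 V_0}|\tilde\Delta_mu(x)-f(x)|\to0$. Let $\mathcal H_n$ be the space of solutions of $\Delta^{n+1}h=0$. The normal derivative at $q_l$ is $$\partial_nu(q_l)=\lim_{k\to\infty}r^{-k}\Big(3u(q_l)-\sum_{j\ne l}u(F_l^kq_j)\Big).$$ For $x\in V_m\setminus V_0$ let $U_m(x)$ be the union of the cells $F_wK$ with $|w|=m$ and $x\in F_wK$. Let $\mathcal H_n(U_m(x))$ be the space of functions $h$ on $U_m(x)$ such that $h\circ F_w\in\mathcal H_n$ for each such $w$; such that, for $0\le i\le n$, $\Delta^ih$ (given on each cell by $(\Delta^ih)\circ F_w=(r_w\mu_w)^{-i}\Delta^i(h\circ F_w)$) takes a single value at $x$; and such that the matching condition at $x$ holds for $0\le i\le n$, namely $\sum_{w,l:\,|w|=m,\;x=F_wq_l}r_w^{-1}\,\partial_n\big((\Delta^ih)\circ F_w\big)(q_l)=0$. **Lemma 6.3.** There is exactly one family of functions $f_{jl}\in\mathcal H_j$ ($j\ge0$, $0\le l<4$) with $\Delta^if_{jl}(q_{l'})=\delta_{ij}\delta_{ll'}$ for all $i\ge 0$ and $0\le l'<4$ (the "easy"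 basis). There are constants $a_j,b_j$ with $\partial_nf_{jl}(q_l)=a_j$ and $\partial_nf_{jl}(q_{l'})=b_j$ for all $j\geq 0$ and $l'\ne l$ (in particular, these limits exist and depend only on $j$), and $a_0=3$, $b_0=-1$. Define $c_0=1$ and $$c_j=\tfrac13a_j+\sum_{s=0}^{j-1}b_{j-s}c_s\qquad(j\ge1).$$ Then for all $n,m\ge0$, all $x\in V_m\setminus V_0$ and all $h\in\mathcal H_n(U_m(x))$, $$\tilde\Delta_mh(x)=12\sum_{j=1}^n\rho^{m(j-1)}c_j\,\Delta^jh(x).$$ -/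

import Mathlib

open Filter Topology MeasureTheory
open scoped ENNReal NNReal

noncomputable section

/-- The raw data of a self-similar set `K` with four boundary points: maps `F_0, …, F_{N-1}`,
boundary points `q_0, …, q_3`, renormalization factors `r_l`, weights `p_l` and a measure `μ`.
The laws they obey are collected in `FractalData.IsD4Symmetric`. -/
structure FractalData (K : Type*) [MeasurableSpace K] where
  N : ℕ
  four_le : 4 ≤ N
  F : Fin N → K → K
  q : Fin 4 → K
  r : Fin N → ℝ
  p : Fin N → ℝ
  μ : Measure K

namespace FractalData

variable {K : Type*} [MeasurableSpace K] (S : FractalData K)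

/-- The index of the map fixing the boundary point `q_l`. -/
def idx (l : Fin 4) : Fin S.N := Fin.castLE S.four_le l

/-- Words `w = w_1 ⋯ w_m` of length `m`. -/
abbrev Word (m : ℕ) : Type := Fin m → Fin S.N

/-- `F_w = F_{w_1} ∘ ⋯ ∘ F_{w_m}`. -/
def cellMap : (m : ℕ) → S.Word m → K → K
  | 0, _ => id
  | m + 1, w => S.F (w 0) ∘ cellMap m (fun i => w i.succ)

/-- `r_w = r_{w_1} ⋯ r_{w_m}`. -/
def rWord {m : ℕ} (w : S.Word m) : ℝ := ∏ i, S.r (w i)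

/-- `μ_w = μ_{w_1} ⋯ μ_{w_m}`. -/
def pWord {m : ℕ} (w : S.Word m) : ℝ := ∏ i, S.p (w i)

/-- The common value `r` of the renormalization factors `r_0, …, r_3`. -/
def r₀ : ℝ := S.r (S.idx 0)

/-- The constant `ρ = r μ`, the product of the renormalization factor and the weight. -/
def ρ : ℝ := S.r (S.idx 0) * S.p (S.idx 0)

/-- The vertices `V_m` of the level-`m` graph: all points `F_w q_i` with `|w| = m`. -/
def V (m : ℕ) : Set K := {x | ∃ (w : S.Word m) (i : Fin 4), S.cellMap m w (S.q i) = x}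

theorem V_finite (m : ℕ) : (S.V m).Finite := by
  have h : S.V m = Set.range (fun z : S.Word m × Fin 4 => S.cellMap m z.1 (S.q z.2)) := by
    ext x; simp [V]
  rw [h]; exact Set.finite_range _

/-- The edge relation `x ∼_m y`: `x = F_w q_i`, `y = F_w q_j` for some word of length `m` and
`i ≠ j`. -/
def Adj (m : ℕ) (x y : K) : Prop :=
  ∃ (w : S.Word m) (i j : Fin 4), i ≠ j ∧ S.cellMap m w (S.q i) = x ∧ S.cellMap m w (S.q j) = y

open Classical in
/-- The level-`m` conductance `c_{xy}`, for level-`0` conductances all equal to `1`: each edge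
`{F_w q_i, F_w q_j}` carries the conductance `r_w⁻¹` (added up if two cells share an edge). -/
def cond (m : ℕ) (x y : K) : ℝ :=
  ∑ w : S.Word m, ∑ i : Fin 4, ∑ j : Fin 4,
    if i ≠ j ∧ S.cellMap m w (S.q i) = x ∧ S.cellMap m w (S.q j) = y then (S.rWord w)⁻¹ else 0

/-- The renormalized graph energy `E_m(u) = ∑_{|w| = m} r_w⁻¹ E_0(u ∘ F_w)`, where
`E_0(u) = ∑_{i < j} (u(q_i) - u(q_j))²`. -/
def energy (m : ℕ) (u : K → ℝ) : ℝ :=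
  ∑ w : S.Word m, (S.rWord w)⁻¹ *
    ∑ i : Fin 4, ∑ j ∈ Finset.Ioi i,
      (u (S.cellMap m w (S.q i)) - u (S.cellMap m w (S.q j))) ^ 2

/-- The energy `E(u) = lim_m E_m(u) ∈ [0, ∞]`, the limit of an increasing sequence. -/
def totalEnergy (u : K → ℝ) : ℝ≥0∞ := ⨆ m, ENNReal.ofReal (S.energy m u)

open Classical in
/-- The graph Laplacian `Δ_m u(x) = ∑_{y ∼_m x} c_{xy} (u(y) - u(x))`. -/
def graphLaplacian (m : ℕ) (u : K → ℝ) (x : K) : ℝ :=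
  ∑ y ∈ (S.V_finite m).toFinset with S.Adj m x y, S.cond m x y * (u y - u x)

section Analysis

variable [TopologicalSpace K]

/-- Harmonic functions: continuous, minimizing the energy from level `m` to level `m + 1` for
each `m`. -/
def IsHarmonic (h : K → ℝ) : Prop :=
  Continuous h ∧
    ∀ m, ∀ v : K → ℝ, (∀ y ∈ S.V m, v y = h y) → S.energy (m + 1) h ≤ S.energy (m + 1) v

/-- `ψ` is the tent function at the vertex `x ∈ V_m`: continuous, harmonic on each cell of
level `m`, with value `1` at `x` and `0` at the other vertices of `V_m`. -/
def IsTent (m : ℕ) (x : K) (ψ : K → ℝ) : Prop :=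
  Continuous ψ ∧ (∀ w : S.Word m, S.IsHarmonic (ψ ∘ S.cellMap m w)) ∧
    ψ x = 1 ∧ ∀ y ∈ S.V m, y ≠ x → ψ y = 0

open Classical in
/-- The tent function `ψ_x^m`. -/
def tent (m : ℕ) (x : K) : K → ℝ :=
  if h : ∃ ψ, S.IsTent m x ψ then h.choose else 0

/-- The renormalized graph Laplacian `(∫ ψ_x^m dμ)⁻¹ Δ_m u(x)`. -/
def renormLaplacian (m : ℕ) (u : K → ℝ) (x : K) : ℝ :=
  (∫ y, S.tent m x y ∂S.μ)⁻¹ * S.graphLaplacian m u x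

/-- `u ∈ dom Δ` and `Δ u = f`: both functions are continuous, and the renormalized graph
Laplacians of `u` converge to `f` uniformly on `V_* \ V_0`. -/
def HasLaplacian (u f : K → ℝ) : Prop :=
  Continuous u ∧ Continuous f ∧
    ∀ ε > 0, ∃ M, ∀ m ≥ M, ∀ x ∈ S.V m, x ∉ S.V 0 → |S.renormLaplacian m u x - f x| < ε

/-- `D 0` is `(n+1)`-harmonic, that is `Δ^{n+1} (D 0) = 0`, and `D i = Δ^i (D 0)` for all
`i ≤ n + 1`. -/
def IsMultiharmonicChain (n : ℕ) (D : ℕ → K → ℝ) : Prop :=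
  (∀ i ≤ n, S.HasLaplacian (D i) (D (i + 1))) ∧ D (n + 1) = 0

/-- The normal derivative of `u` at the boundary point `q_l` exists and equals `d`:
`d = lim_k r^{-k} (3 u(q_l) - ∑_{j ≠ l} u(F_l^k q_j))`. -/
def HasNormalDeriv (u : K → ℝ) (l : Fin 4) (d : ℝ) : Prop :=
  Tendsto
    (fun k : ℕ => (S.r₀ ^ k)⁻¹ *
      (3 * u (S.q l) - ∑ j ∈ Finset.univ.erase l, u ((S.F (S.idx l))^[k] (S.q j))))
    atTop (𝓝 d)

/-- The easy basis: `f j l` is `(j+1)`-harmonic and `Δ^i (f j l) (q_{l'}) = δ_{ij} δ_{ll'}`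
(for `i > j` the left side is the zero function). -/
def IsEasyBasis (f : ℕ → Fin 4 → K → ℝ) : Prop :=
  ∀ j l, ∃ D : ℕ → K → ℝ, D 0 = f j l ∧ S.IsMultiharmonicChain j D ∧
    ∀ i ≤ j, ∀ l', D i (S.q l') = if i = j ∧ l = l' then 1 else 0

open Classical in
/-- `h` belongs to the space of `(n+1)`-harmonic functions on the neighborhood `U_m(x)`, the union
of the cells `F_w K` with `|w| = m` and `x ∈ F_w K`, and `A i = Δ^i h(x)` for `i ≤ n`.
Only the values of `h` on `U_m(x)` matter.

`D i w` is `(Δ^i h) ∘ F_w`; the scaling identity `Δ^i (h ∘ F_w) = (r_w μ_w)^i (Δ^i h) ∘ F_w` turns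
the requirement that `h ∘ F_w` is `(n+1)`-harmonic on `K` into the second clause. The third clause
says that `Δ^i h` has one and the same value at `x` on all cells meeting at `x`. The fourth is the
matching condition at `x`: the sum of the normal derivatives
`∂_n^w Δ^i h(x) = r_w⁻¹ ∂_n ((Δ^i h) ∘ F_w)(q_l)`, over all cells `F_w K` with `x = F_w q_l`,
vanishes (if there is just one cell at `x`, the normal derivative itself vanishes). -/
def IsLocalMultiharmonic (n m : ℕ) (x : K) (h : K → ℝ) (A : ℕ → ℝ) : Prop :=
  ∃ D : ℕ → S.Word m → K → ℝ,
    (∀ w, x ∈ Set.range (S.cellMap m w) → D 0 w = h ∘ S.cellMap m w) ∧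
    (∀ w, x ∈ Set.range (S.cellMap m w) →
      S.IsMultiharmonicChain n (fun i z => (S.rWord w * S.pWord w) ^ i * D i w z)) ∧
    (∀ i ≤ n, ∀ w l, S.cellMap m w (S.q l) = x → D i w (S.q l) = A i) ∧
    (∀ i ≤ n, ∃ d : S.Word m → Fin 4 → ℝ,
      (∀ w l, S.cellMap m w (S.q l) = x → S.HasNormalDeriv (D i w) l (d w l)) ∧
      (∑ w, ∑ l, if S.cellMap m w (S.q l) = x then (S.rWord w)⁻¹ * d w l else 0) = 0)

end Analysis

/-- The standing assumptions: a p.c.f. self-similar set with four boundary points, a regular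
harmonic structure with all level-`0` conductances equal to `1`, a self-similar probability measure
with `r_l μ_l = ρ` for all `l`, and full symmetry: every permutation of the four boundary points is
induced by a homeomorphism that leaves the energy and the measure invariant. -/
structure IsD4Symmetric [MetricSpace K] : Prop where
  contracting : ∀ l, ∃ c : ℝ≥0, ContractingWith c (S.F l)
  injective : ∀ l, Function.Injective (S.F l)
  cover : ⋃ l, Set.range (S.F l) = Set.univ
  q_injective : Function.Injective S.q
  fixed : ∀ l, S.F (S.idx l) (S.q l) = S.q l
  /-- Distinct cells of one level meet only at images of boundary points under both maps, and never
  at a point of `V_0`. -/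
  pcf : ∀ (m : ℕ) (w w' : S.Word m), w ≠ w' →
    Set.range (S.cellMap m w) ∩ Set.range (S.cellMap m w') ⊆
      (S.cellMap m w '' S.V 0 ∩ S.cellMap m w' '' S.V 0) \ S.V 0
  r_pos : ∀ l, 0 < S.r l
  r_lt_one : ∀ l, S.r l < 1
  /-- The restriction of `E_1` to `V_0` is `E_0`: the least energy `E_1` among all functions with
  given values on `V_0` is `E_0` of these values. -/
  harmonicStructure : ∀ u : K → ℝ,
    IsLeast (S.energy 1 '' {v | ∀ y ∈ S.V 0, v y = u y}) (S.energy 0 u)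
  p_pos : ∀ l, 0 < S.p l
  p_sum : ∑ l, S.p l = 1
  isProbabilityMeasure : IsProbabilityMeasure S.μ
  selfSimilar : S.μ = ∑ l, ENNReal.ofReal (S.p l) • S.μ.map (S.F l)
  r_boundary : ∀ l : Fin 4, S.r (S.idx l) = S.r₀
  r_mul_p : ∀ l, S.r l * S.p l = S.ρ
  symmetric : ∀ σ : Equiv.Perm (Fin 4), ∃ g : K ≃ₜ K,
    (∀ l, g (S.q l) = S.q (σ l)) ∧
    (∀ u : K → ℝ, Continuous u → S.totalEnergy (u ∘ g) = S.totalEnergy u) ∧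
    S.μ.map g = S.μ

end FractalData

end

/-! The analysis is carried by a weak equation that is exact at every level. `pairing h m f φ`
integrates `f` against the harmonic spline of level `m` that interpolates `φ`, and `IsWeakSolution`
says that form plus pairing does not depend on `m`: a discrete Gauss–Green formula without limits.
Testing with vertex indicators yields the graph Laplacian at interior vertices and, at `q_l`, the
normal derivative (`hasNormalDeriv`). Weak solutions vanishing on `V_0` come from a self-similar
recursion contracting by `ρ` (`exists_weakSolution`). They satisfy `Δ u = f` in the uniform sense
(`hasLaplacian`), and `Δ u` with boundary values determines `u` (`eq_of_hasLaplacian`). Hence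
iterating the Green operator on the harmonic basis gives the easy basis, and every multiharmonic
function is a combination of it (`chain_eq_chainOf`). Extension matrices are never inverted, so they
may be degenerate.

The symmetries carry weak solutions to weak solutions (`weakSolution_comp`). As permutations act
transitively on ordered pairs of distinct boundary points, the normal derivatives of the easy basis
reduce to two sequences `a`, `b`.

At a vertex `x`, let `R` be the sum of `r_w⁻¹` over the corners equal to `x`, and let `T_j` be the
sum, with the same weights, of the values of `Δ^j h` at the other corners of those cells. Since `r_w
μ_w = ρ^m` for every cell, the matching conditions become `∑_t (a_t α_{i+t} + b_t β_{i+t}) = 0` with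
`α_j = ρ^{mj} R Δ^j h(x)` and `β_j = ρ^{mj} T_j`. This system is triangular with `a_0 = 3`, `b_0 =
-1`; the `c_j` are its inverse, so `β_0 = 3 ∑ c_j α_j` (`solve_matching`). Now `Δ_m h(x) = β_0 - 3
α_0` removes the term `j = 0`, and the tent integral `ρ^m R / 4` turns the factor 3 into 12. -/

namespace FractalData

/-! ### Graph energies as bilinear forms and sums over corners of cells -/

section Combinatorics

variable {K : Type*} [MeasurableSpace K] (S : FractalData K)

/-- The bilinear form of the level-`m` energy. -/
noncomputable def form (m : ℕ) (u φ : K → ℝ) : ℝ :=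
  ∑ w : S.Word m, (S.rWord w)⁻¹ * ∑ i, φ (S.cellMap m w (S.q i)) *
    (4 * u (S.cellMap m w (S.q i)) - ∑ j, u (S.cellMap m w (S.q j)))

theorem sum_word_succ {M : Type*} [AddCommMonoid M] {m : ℕ} (g : S.Word (m + 1) → M) :
    ∑ w, g w = ∑ k, ∑ w : S.Word m, g (Fin.cons k w) := by
  rw [← (Fin.consEquiv (fun _ : Fin (m + 1) => Fin S.N)).sum_comp, Fintype.sum_prod_type]
  rfl

@[simp] theorem cellMap_zero (w : S.Word 0) (x : K) : S.cellMap 0 w x = x := rfl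

@[simp] theorem cellMap_cons {m : ℕ} (k : Fin S.N) (w : S.Word m) (x : K) :
    S.cellMap (m + 1) (Fin.cons k w) x = S.F k (S.cellMap m w x) := rfl

@[simp] theorem rWord_zero (w : S.Word 0) : S.rWord w = 1 := by simp [rWord]

@[simp] theorem pWord_zero (w : S.Word 0) : S.pWord w = 1 := by simp [pWord]

@[simp] theorem rWord_cons {m : ℕ} (k : Fin S.N) (w : S.Word m) :
    S.rWord (Fin.cons k w : S.Word (m + 1)) = S.r k * S.rWord w := by
  simp [rWord, Fin.prod_univ_succ]

@[simp] theorem pWord_cons {m : ℕ} (k : Fin S.N) (w : S.Word m) :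
    S.pWord (Fin.cons k w : S.Word (m + 1)) = S.p k * S.pWord w := by
  simp [pWord, Fin.prod_univ_succ]

theorem cellMap_const (m : ℕ) (k : Fin S.N) :
    S.cellMap m (fun _ => k) = (S.F k)^[m] := by
  induction m with
  | zero => rfl
  | succ m ih =>
    rw [Function.iterate_succ', ← ih]
    rfl

theorem form_zero (u φ : K → ℝ) :
    S.form 0 u φ = ∑ i, φ (S.q i) * (4 * u (S.q i) - ∑ j, u (S.q j)) := by
  simp [form]

theorem form_succ (m : ℕ) (u φ : K → ℝ) :
    S.form (m + 1) u φ = ∑ k, (S.r k)⁻¹ * S.form m (u ∘ S.F k) (φ ∘ S.F k) := by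
  simp only [form, sum_word_succ, cellMap_cons, rWord_cons, Finset.mul_sum, mul_inv,
    Function.comp_apply, mul_assoc]

theorem form_one (u φ : K → ℝ) :
    S.form 1 u φ = ∑ k, (S.r k)⁻¹ * S.form 0 (u ∘ S.F k) (φ ∘ S.F k) :=
  S.form_succ 0 u φ

theorem form_comm (m : ℕ) (u φ : K → ℝ) : S.form m u φ = S.form m φ u := by
  refine Finset.sum_congr rfl fun w _ => ?_
  congr 1
  simp only [Fin.sum_univ_four]
  ring

theorem form_add_left (m : ℕ) (u v φ : K → ℝ) :
    S.form m (u + v) φ = S.form m u φ + S.form m v φ := by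
  simp only [form, ← Finset.sum_add_distrib, ← mul_add, Pi.add_apply]
  refine Finset.sum_congr rfl fun w _ => ?_
  congr 1
  refine Finset.sum_congr rfl fun i _ => ?_
  rw [Finset.sum_add_distrib]
  ring

theorem form_smul_left (m : ℕ) (c : ℝ) (u φ : K → ℝ) :
    S.form m (c • u) φ = c * S.form m u φ := by
  simp only [form, Finset.mul_sum, Pi.smul_apply, smul_eq_mul]
  refine Finset.sum_congr rfl fun w _ => ?_
  refine Finset.sum_congr rfl fun i _ => ?_
  rw [← Finset.mul_sum]
  ring

theorem form_sub_left (m : ℕ) (u v φ : K → ℝ) :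
    S.form m (u - v) φ = S.form m u φ - S.form m v φ := by
  have h := S.form_add_left m (u - v) v φ
  rw [sub_add_cancel] at h
  linarith

theorem form_sum_left {ι : Type*} (s : Finset ι) (m : ℕ) (u : ι → K → ℝ) (φ : K → ℝ) :
    S.form m (∑ i ∈ s, u i) φ = ∑ i ∈ s, S.form m (u i) φ := by
  classical
  induction s using Finset.induction_on with
  | empty => simpa using S.form_smul_left m 0 0 φ
  | insert a s ha ih => rw [Finset.sum_insert ha, Finset.sum_insert ha, form_add_left, ih]

theorem form_add_right (m : ℕ) (u v φ : K → ℝ) :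
    S.form m φ (u + v) = S.form m φ u + S.form m φ v := by
  simp only [S.form_comm m φ, form_add_left]

theorem form_sub_right (m : ℕ) (u v φ : K → ℝ) :
    S.form m φ (u - v) = S.form m φ u - S.form m φ v := by
  simp only [S.form_comm m φ, form_sub_left]

theorem form_smul_right (m : ℕ) (c : ℝ) (u φ : K → ℝ) :
    S.form m φ (c • u) = c * S.form m φ u := by
  simp only [S.form_comm m φ, form_smul_left]

theorem form_congr {m : ℕ} {u v φ ψ : K → ℝ} (h : ∀ y ∈ S.V m, u y = v y)
    (h' : ∀ y ∈ S.V m, φ y = ψ y) : S.form m u φ = S.form m v ψ := by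
  have h1 : ∀ (w : S.Word m) i, u (S.cellMap m w (S.q i)) = v (S.cellMap m w (S.q i)) :=
    fun w i => h _ ⟨w, i, rfl⟩
  have h2 : ∀ (w : S.Word m) i, φ (S.cellMap m w (S.q i)) = ψ (S.cellMap m w (S.q i)) :=
    fun w i => h' _ ⟨w, i, rfl⟩
  simp only [form, h1, h2]

theorem form_one_left (m : ℕ) (φ : K → ℝ) : S.form m (fun _ => 1) φ = 0 := by
  simp [form]

theorem sum_Ioi_sq_sub (a : Fin 4 → ℝ) :
    ∑ i : Fin 4, ∑ j ∈ Finset.Ioi i, (a i - a j) ^ 2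
      = ∑ i, a i * (4 * a i - ∑ j, a j) := by
  have h0 : Finset.Ioi (0 : Fin 4) = {1, 2, 3} := by decide
  have h1 : Finset.Ioi (1 : Fin 4) = {2, 3} := by decide
  have h2 : Finset.Ioi (2 : Fin 4) = {3} := by decide
  have h3 : Finset.Ioi (3 : Fin 4) = ∅ := by decide
  simp only [Fin.sum_univ_four, h0, h1, h2, h3, Finset.sum_empty, Finset.sum_singleton]
  rw [Finset.sum_insert (by decide), Finset.sum_insert (by decide),
    Finset.sum_insert (by decide), Finset.sum_singleton, Finset.sum_singleton]
  ring

theorem energy_eq_form (m : ℕ) (u : K → ℝ) : S.energy m u = S.form m u u := by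
  refine Finset.sum_congr rfl fun w _ => ?_
  rw [← sum_Ioi_sq_sub fun i => u (S.cellMap m w (S.q i))]

theorem energy_succ (m : ℕ) (u : K → ℝ) :
    S.energy (m + 1) u = ∑ k, (S.r k)⁻¹ * S.energy m (u ∘ S.F k) := by
  simp only [energy_eq_form, form_succ]

theorem energy_add (m : ℕ) (u v : K → ℝ) :
    S.energy m (u + v) = S.energy m u + 2 * S.form m u v + S.energy m v := by
  simp only [energy_eq_form, form_add_left, form_add_right]
  rw [S.form_comm m v u]
  ring

theorem mem_V_zero {x : K} : x ∈ S.V 0 ↔ ∃ i, S.q i = x := by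
  constructor
  · rintro ⟨w, i, h⟩; exact ⟨i, h⟩
  · rintro ⟨i, h⟩; exact ⟨default, i, h⟩

theorem mem_V_succ {m : ℕ} {x : K} : x ∈ S.V (m + 1) ↔ ∃ k, ∃ y ∈ S.V m, S.F k y = x := by
  constructor
  · rintro ⟨w, i, h⟩
    exact ⟨w 0, _, ⟨fun i => w i.succ, i, rfl⟩, h⟩
  · rintro ⟨k, _, ⟨w, i, rfl⟩, h⟩
    exact ⟨Fin.cons k w, i, h⟩

open Classical in
/-- Summation over vertices of a quantity collected from the corners of the cells. -/
theorem sum_vertices (m : ℕ) (φ : K → ℝ) (g : S.Word m → Fin 4 → ℝ) :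
    ∑ x ∈ (S.V_finite m).toFinset,
      φ x * (∑ w, ∑ i, if S.cellMap m w (S.q i) = x then g w i else 0)
      = ∑ w, ∑ i, φ (S.cellMap m w (S.q i)) * g w i := by
  simp only [Finset.mul_sum, mul_ite, mul_zero]
  rw [Finset.sum_comm]
  refine Finset.sum_congr rfl fun w _ => ?_
  rw [Finset.sum_comm]
  refine Finset.sum_congr rfl fun i _ => ?_
  rw [Finset.sum_ite_eq, if_pos]
  exact (S.V_finite m).mem_toFinset.2 ⟨w, i, rfl⟩

-- Pairs that are not adjacent have conductance zero, so the sum may run over all of `V_m` and be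
-- regrouped by cells; the diagonal term `j = i` contributes zero, which explains the factor 4
-- instead of 3.
open Classical in
theorem graphLaplacian_eq (m : ℕ) (u : K → ℝ) (x : K) :
    S.graphLaplacian m u x = ∑ w, ∑ i, if S.cellMap m w (S.q i) = x then
      (S.rWord w)⁻¹ * (∑ j, u (S.cellMap m w (S.q j)) - 4 * u (S.cellMap m w (S.q i)))
      else 0 := by
  classical
  have h1 : S.graphLaplacian m u x
      = ∑ y ∈ (S.V_finite m).toFinset, S.cond m x y * (u y - u x) := by
    unfold graphLaplacian
    refine Finset.sum_subset_zero_on_sdiff (Finset.filter_subset _ _) ?_ fun y _ => by rfl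
    intro y hy
    have hy' : ¬ S.Adj m x y := by
      intro h
      simp only [Finset.mem_sdiff, Finset.mem_filter, not_and] at hy
      exact hy.2 hy.1 h
    have : S.cond m x y = 0 := by
      refine Finset.sum_eq_zero fun w _ => Finset.sum_eq_zero fun i _ =>
        Finset.sum_eq_zero fun j _ => if_neg fun h => hy' ⟨w, i, j, h⟩
    rw [this, zero_mul]
  rw [h1]
  simp only [cond, Finset.sum_mul]
  rw [Finset.sum_comm]
  refine Finset.sum_congr rfl fun w _ => ?_
  rw [Finset.sum_comm]
  refine Finset.sum_congr rfl fun i _ => ?_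
  rw [Finset.sum_comm]
  by_cases hx : S.cellMap m w (S.q i) = x
  · subst hx
    rw [if_pos rfl]
    have h2 : ∀ j, ∑ y ∈ (S.V_finite m).toFinset,
        (if i ≠ j ∧ S.cellMap m w (S.q i) = S.cellMap m w (S.q i) ∧ S.cellMap m w (S.q j) = y
          then (S.rWord w)⁻¹ else 0) * (u y - u (S.cellMap m w (S.q i)))
        = (S.rWord w)⁻¹ * (u (S.cellMap m w (S.q j)) - u (S.cellMap m w (S.q i))) := by
      intro j
      by_cases hij : i = j
      · subst hij; simp
      · rw [Finset.sum_eq_single (S.cellMap m w (S.q j))]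
        · simp [hij]
        · intro y _ hy
          rw [if_neg (fun h => hy h.2.2.symm), zero_mul]
        · intro h
          exact absurd ((S.V_finite m).mem_toFinset.2 ⟨w, j, rfl⟩) h
    rw [Finset.sum_congr rfl fun j _ => h2 j, ← Finset.mul_sum, Finset.sum_sub_distrib]
    simp
  · simp [hx]

open Classical in
/-- The graph Laplacian in terms of the energy form. -/
theorem form_indicator (m : ℕ) (u : K → ℝ) (x : K) :
    S.form m u (fun y => if y = x then 1 else 0) = - S.graphLaplacian m u x := by
  rw [graphLaplacian_eq, form, ← Finset.sum_neg_distrib]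
  refine Finset.sum_congr rfl fun w _ => ?_
  rw [← Finset.sum_neg_distrib, Finset.mul_sum]
  refine Finset.sum_congr rfl fun i _ => ?_
  split_ifs <;> ring

open Classical in
theorem form_eq_sum_vertices (m : ℕ) (u φ : K → ℝ) :
    S.form m u φ = - ∑ x ∈ (S.V_finite m).toFinset, φ x * S.graphLaplacian m u x := by
  simp only [graphLaplacian_eq]
  rw [S.sum_vertices m φ, form, ← Finset.sum_neg_distrib]
  refine Finset.sum_congr rfl fun w _ => ?_
  rw [← Finset.sum_neg_distrib, Finset.mul_sum]
  refine Finset.sum_congr rfl fun i _ => ?_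
  ring

end Combinatorics

end FractalData

/-! ### Cells, scaling factors and definiteness of the energy -/

namespace FractalData

namespace IsD4Symmetric

variable {K : Type*} [MetricSpace K] [MeasurableSpace K] {S : FractalData K}

theorem continuous_F (hS : S.IsD4Symmetric) (k : Fin S.N) : Continuous (S.F k) := by
  obtain ⟨c, hc⟩ := hS.contracting k
  exact hc.2.continuous

theorem continuous_cellMap (hS : S.IsD4Symmetric) : ∀ (m : ℕ) (w : S.Word m),
    Continuous (S.cellMap m w)
  | 0, _ => continuous_id
  | m + 1, _ => (hS.continuous_F _).comp (hS.continuous_cellMap m _)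

theorem cellMap_injective (hS : S.IsD4Symmetric) : ∀ (m : ℕ) (w : S.Word m),
    Function.Injective (S.cellMap m w)
  | 0, _ => Function.injective_id
  | m + 1, _ => (hS.injective _).comp (hS.cellMap_injective m _)

theorem rWord_pos (hS : S.IsD4Symmetric) {m : ℕ} (w : S.Word m) : 0 < S.rWord w :=
  Finset.prod_pos fun i _ => hS.r_pos (w i)

theorem pWord_pos (hS : S.IsD4Symmetric) {m : ℕ} (w : S.Word m) : 0 < S.pWord w :=
  Finset.prod_pos fun i _ => hS.p_pos (w i)

theorem rho_pos (hS : S.IsD4Symmetric) : 0 < S.ρ := mul_pos (hS.r_pos _) (hS.p_pos _)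

theorem p_lt_one (hS : S.IsD4Symmetric) (k : Fin S.N) : S.p k < 1 := by
  have h4 := S.four_le
  obtain ⟨l, hl⟩ : ∃ l : Fin S.N, l ≠ k := by
    have : Nontrivial (Fin S.N) := Fin.nontrivial_iff_two_le.2 (by omega)
    exact exists_ne k
  rw [← hS.p_sum]
  exact Finset.single_lt_sum hl (Finset.mem_univ _) (Finset.mem_univ _) (hS.p_pos l)
    fun j _ _ => (hS.p_pos j).le

theorem rho_lt_one (hS : S.IsD4Symmetric) : S.ρ < 1 :=
  mul_lt_one_of_nonneg_of_lt_one_left (hS.r_pos _).le (hS.r_lt_one _) (hS.p_lt_one _).le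

/-- This uniformity makes the Laplacian scale by the same factor on all cells of a level, so that
contributions of different cells at a vertex can be added. -/
theorem rWord_mul_pWord (hS : S.IsD4Symmetric) {m : ℕ} (w : S.Word m) :
    S.rWord w * S.pWord w = S.ρ ^ m := by
  rw [rWord, pWord, ← Finset.prod_mul_distrib]
  simp [hS.r_mul_p]

theorem pWord_eq (hS : S.IsD4Symmetric) {m : ℕ} (w : S.Word m) :
    S.pWord w = S.ρ ^ m * (S.rWord w)⁻¹ := by
  rw [← hS.rWord_mul_pWord w]
  field_simp [(hS.rWord_pos w).ne']

theorem sum_pWord (hS : S.IsD4Symmetric) (m : ℕ) : ∑ w : S.Word m, S.pWord w = 1 := by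
  induction m with
  | zero => simp
  | succ m ih =>
    simp only [sum_word_succ, pWord_cons, ← Finset.mul_sum, ih, mul_one, hS.p_sum]

theorem exists_cell (hS : S.IsD4Symmetric) : ∀ (m : ℕ) (x : K),
    ∃ (w : S.Word m) (y : K), S.cellMap m w y = x
  | 0, x => ⟨default, x, rfl⟩
  | m + 1, x => by
    have hx : x ∈ ⋃ l, Set.range (S.F l) := hS.cover ▸ Set.mem_univ x
    obtain ⟨k, y, rfl⟩ := Set.mem_iUnion.1 hx
    obtain ⟨w, z, rfl⟩ := exists_cell hS m y
    exact ⟨Fin.cons k w, z, rfl⟩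

theorem V_zero_subset (hS : S.IsD4Symmetric) : ∀ (m : ℕ), S.V 0 ⊆ S.V m
  | 0 => subset_rfl
  | m + 1 => fun x hx => by
    obtain ⟨i, rfl⟩ := S.mem_V_zero.1 hx
    exact S.mem_V_succ.2 ⟨S.idx i, S.q i, V_zero_subset hS m hx, hS.fixed i⟩

/-- Distinct cells of one level meet only at common corners. -/
theorem eq_corner_of_cellMap_eq (hS : S.IsD4Symmetric) {m : ℕ} {w w' : S.Word m} (hw : w ≠ w')
    {y y' : K} (h : S.cellMap m w y = S.cellMap m w' y') :
    (∃ i, S.q i = y) ∧ (∃ j, S.q j = y') ∧ S.cellMap m w y ∉ S.V 0 := by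
  have hx := hS.pcf m w w' hw ⟨⟨y, rfl⟩, ⟨y', h.symm⟩⟩
  obtain ⟨⟨⟨z, hz, hzy⟩, ⟨z', hz', hzy'⟩⟩, h0⟩ := hx
  have e1 := hS.cellMap_injective m w hzy
  have e2 := hS.cellMap_injective m w' (hzy'.trans h)
  subst e1 e2
  exact ⟨S.mem_V_zero.1 hz, S.mem_V_zero.1 hz', h0⟩

theorem eq_corner_of_F_eq (hS : S.IsD4Symmetric) {k l : Fin S.N} (hkl : k ≠ l)
    {y y' : K} (h : S.F k y = S.F l y') :
    (∃ i, S.q i = y) ∧ (∃ j, S.q j = y') ∧ S.F k y ∉ S.V 0 := by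
  have hw : (Fin.cons k default : S.Word 1) ≠ Fin.cons l default :=
    fun e => hkl (by simpa using congrFun e 0)
  exact hS.eq_corner_of_cellMap_eq (m := 1) hw h

/-- The only cell of a given level that contains the boundary point `q_l`. -/
theorem cellMap_eq_q_iff (hS : S.IsD4Symmetric) {m : ℕ} {w : S.Word m} {i l : Fin 4} :
    S.cellMap m w (S.q i) = S.q l ↔ w = (fun _ => S.idx l) ∧ i = l := by
  have hq : ∀ m, S.cellMap m (fun _ => S.idx l) (S.q l) = S.q l := by
    intro m
    induction m with
    | zero => rfl
    | succ m ih =>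
      have : (fun _ => S.idx l : S.Word (m + 1)) = Fin.cons (S.idx l) (fun _ => S.idx l) := by
        funext i; refine Fin.cases ?_ (fun i => ?_) i <;> simp
      rw [this, cellMap_cons, ih, hS.fixed]
  constructor
  · intro h
    by_cases hw : w = (fun _ => S.idx l)
    · subst hw
      exact ⟨rfl, hS.q_injective (hS.cellMap_injective m _ (h.trans (hq m).symm))⟩
    · exact absurd (S.mem_V_zero.2 ⟨l, h.symm⟩)
        (hS.eq_corner_of_cellMap_eq hw (h.trans (hq m).symm)).2.2
  · rintro ⟨rfl, rfl⟩
    exact hq m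

theorem energy_zero_le_one (hS : S.IsD4Symmetric) (u : K → ℝ) :
    S.energy 0 u ≤ S.energy 1 u :=
  (hS.harmonicStructure u).2 ⟨u, fun _ _ => rfl, rfl⟩

/-- Self-similarity `E_{m+1}(u) = ∑ r_k⁻¹ E_m(u ∘ F_k)` propagates the comparison of levels 0 and 1
to all levels. -/
theorem energy_mono (hS : S.IsD4Symmetric) (u : K → ℝ) : Monotone fun m => S.energy m u := by
  refine monotone_nat_of_le_succ fun m => ?_
  induction m generalizing u with
  | zero => exact hS.energy_zero_le_one u
  | succ m ih =>
    rw [S.energy_succ m, S.energy_succ (m + 1)]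
    exact Finset.sum_le_sum fun k _ => mul_le_mul_of_nonneg_left (ih _)
      (inv_nonneg.2 (hS.r_pos k).le)

theorem energy_nonneg (hS : S.IsD4Symmetric) (m : ℕ) (u : K → ℝ) : 0 ≤ S.energy m u :=
  Finset.sum_nonneg fun w _ => mul_nonneg (inv_nonneg.2 (hS.rWord_pos w).le)
    (Finset.sum_nonneg fun _ _ => Finset.sum_nonneg fun _ _ => sq_nonneg _)

theorem eq_of_energy_nonpos (hS : S.IsD4Symmetric) {m : ℕ} {u : K → ℝ} (h : S.energy m u ≤ 0)
    (w : S.Word m) (i j : Fin 4) : u (S.cellMap m w (S.q i)) = u (S.cellMap m w (S.q j)) := by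
  have h0 := le_antisymm h (hS.energy_nonneg m u)
  have h1 := (Finset.sum_eq_zero_iff_of_nonneg fun w _ => mul_nonneg
    (inv_nonneg.2 (hS.rWord_pos w).le)
    (Finset.sum_nonneg fun _ _ => Finset.sum_nonneg fun _ _ => sq_nonneg _)).1 h0 w
    (Finset.mem_univ _)
  have h2 := (mul_eq_zero.1 h1).resolve_left (inv_pos.2 (hS.rWord_pos w)).ne'
  have key : ∀ a b : Fin 4, a < b →
      u (S.cellMap m w (S.q a)) = u (S.cellMap m w (S.q b)) := by
    intro a b hab
    have h3 := (Finset.sum_eq_zero_iff_of_nonneg fun i _ =>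
      Finset.sum_nonneg fun j _ => sq_nonneg _).1 h2 a (Finset.mem_univ _)
    have h4 := (Finset.sum_eq_zero_iff_of_nonneg fun j _ => sq_nonneg _).1 h3 b
      (Finset.mem_Ioi.2 hab)
    exact sub_eq_zero.1 (pow_eq_zero_iff two_ne_zero |>.1 h4)
  rcases lt_trichotomy i j with hij | rfl | hij
  · exact key _ _ hij
  · rfl
  · exact (key _ _ hij).symm

variable [CompactSpace K]

/-- Continuous functions have uniformly small oscillation on cells of high level. -/
theorem eventually_osc_lt (hS : S.IsD4Symmetric) {u : K → ℝ} (hu : Continuous u) {ε : ℝ}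
    (hε : 0 < ε) : ∃ M, ∀ m ≥ M, ∀ (w : S.Word m) (x y : K),
      |u (S.cellMap m w x) - u (S.cellMap m w y)| < ε := by
  obtain ⟨δ, hδ, h⟩ := Metric.uniformContinuous_iff.1
    (CompactSpace.uniformContinuous_of_continuous hu) ε hε
  choose c hc using hS.contracting
  have : Nonempty (Fin S.N) := ⟨S.idx 0⟩
  set C : ℝ≥0 := Finset.univ.sup' Finset.univ_nonempty c
  have hC : C < 1 := by
    obtain ⟨k, _, hk⟩ := Finset.exists_mem_eq_sup' Finset.univ_nonempty c
    exact (show C = c k from hk) ▸ (hc k).1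
  have hF : ∀ k x y, dist (S.F k x) (S.F k y) ≤ C * dist x y := fun k x y =>
    ((hc k).2.dist_le_mul x y).trans (mul_le_mul_of_nonneg_right
      (NNReal.coe_le_coe.2 (Finset.le_sup' c (Finset.mem_univ k))) dist_nonneg)
  have hm : ∀ (m : ℕ) (w : S.Word m) x y,
      dist (S.cellMap m w x) (S.cellMap m w y) ≤ (C : ℝ) ^ m * dist x y := by
    intro m
    induction m with
    | zero => intro w x y; simp
    | succ m ih =>
      intro w x y
      refine (hF _ _ _).trans ?_
      rw [pow_succ', mul_assoc]
      exact mul_le_mul_of_nonneg_left (ih _ x y) C.coe_nonneg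
  have ht : Tendsto (fun m : ℕ => (C : ℝ) ^ m * Metric.diam (Set.univ : Set K)) atTop (𝓝 0) := by
    simpa using (tendsto_pow_atTop_nhds_zero_of_lt_one C.coe_nonneg
      (NNReal.coe_lt_one.2 hC)).mul_const (Metric.diam (Set.univ : Set K))
  obtain ⟨M, hM⟩ := eventually_atTop.1 (ht.eventually_lt_const hδ)
  refine ⟨M, fun m hmM w x y => ?_⟩
  rw [← Real.dist_eq]
  refine h ((hm m w x y).trans_lt (lt_of_le_of_lt ?_ (hM m hmM)))
  exact mul_le_mul_of_nonneg_left (Metric.dist_le_diam_of_mem isCompact_univ.isBounded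
    (Set.mem_univ _) (Set.mem_univ _)) (pow_nonneg C.coe_nonneg m)

/-- A continuous function is determined by its values on `V_*`. -/
theorem ext_of_vertices (hS : S.IsD4Symmetric) {u v : K → ℝ} (hu : Continuous u)
    (hv : Continuous v) (h : ∀ m, ∀ y ∈ S.V m, u y = v y) : u = v := by
  funext x
  refine eq_of_abs_sub_le_all fun ε hε => ?_
  obtain ⟨M, hM⟩ := hS.eventually_osc_lt (hu.sub hv) hε
  obtain ⟨w, y, rfl⟩ := hS.exists_cell M x
  have h1 := hM M le_rfl w y (S.q 0)
  have h2 := h M _ ⟨w, 0, rfl⟩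
  simp only [Pi.sub_apply, h2, sub_self, sub_zero] at h1
  exact h1.le

variable [ConnectedSpace K]

/-- A function of zero energy is constant on the vertices. -/
theorem const_of_energy_nonpos (hS : S.IsD4Symmetric) {m : ℕ} {u : K → ℝ}
    (h : S.energy m u ≤ 0) {x y : K} (hx : x ∈ S.V m) (hy : y ∈ S.V m) : u x = u y := by
  obtain ⟨w₀, i₀, rfl⟩ := hx
  set t := u (S.cellMap m w₀ (S.q i₀))
  -- On the corners of a single cell `u` is constant. The cells with value `t` and the others form
  -- two closed sets covering `K`; by connectedness they meet, and by the p.c.f. condition they do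
  -- so at a common corner, where the two values would have to agree.
  let P : S.Word m → Prop := fun w => u (S.cellMap m w (S.q 0)) = t
  have hcl : ∀ Q : S.Word m → Prop, IsClosed (⋃ w ∈ {w | Q w}, Set.range (S.cellMap m w)) :=
    fun Q => (Set.toFinite _).isClosed_biUnion fun w _ =>
      (isCompact_range (hS.continuous_cellMap m w)).isClosed
  have hne : (Set.univ ∩ ⋃ w ∈ {w | P w}, Set.range (S.cellMap m w)).Nonempty :=
    ⟨_, trivial, Set.mem_biUnion (show P w₀ from hS.eq_of_energy_nonpos h w₀ 0 i₀)
      ⟨S.q i₀, rfl⟩⟩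
  by_contra hxy
  obtain ⟨w₁, i₁, rfl⟩ := hy
  have hne' : (Set.univ ∩ ⋃ w ∈ {w | ¬ P w}, Set.range (S.cellMap m w)).Nonempty :=
    ⟨_, trivial, Set.mem_biUnion (show ¬ P w₁ from fun e => hxy
      (e.symm.trans (hS.eq_of_energy_nonpos h w₁ 0 i₁))) ⟨S.q i₁, rfl⟩⟩
  have hcov : (Set.univ : Set K) ⊆ (⋃ w ∈ {w | P w}, Set.range (S.cellMap m w)) ∪
      ⋃ w ∈ {w | ¬ P w}, Set.range (S.cellMap m w) := by
    intro z _
    obtain ⟨w, y, rfl⟩ := hS.exists_cell m z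
    by_cases hw : P w
    · exact Or.inl (Set.mem_biUnion hw ⟨y, rfl⟩)
    · exact Or.inr (Set.mem_biUnion hw ⟨y, rfl⟩)
  obtain ⟨z, _, hz1, hz2⟩ := isPreconnected_closed_iff.1 isPreconnected_univ _ _
    (hcl P) (hcl fun w => ¬ P w) hcov hne hne'
  obtain ⟨w, hw, y, rfl⟩ := Set.mem_iUnion₂.1 hz1
  obtain ⟨w', hw', y', hyy⟩ := Set.mem_iUnion₂.1 hz2
  have hww : w ≠ w' := fun e => hw' (e ▸ hw)
  obtain ⟨⟨i, rfl⟩, ⟨j, rfl⟩, -⟩ := hS.eq_corner_of_cellMap_eq hww hyy.symm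
  apply hw'
  change u (S.cellMap m w' (S.q 0)) = t
  rw [hS.eq_of_energy_nonpos h w' 0 j, hyy, hS.eq_of_energy_nonpos h w i 0]
  exact hw

theorem eq_zero_of_energy_nonpos (hS : S.IsD4Symmetric) {m : ℕ} {u : K → ℝ}
    (h : S.energy m u ≤ 0) (h0 : ∀ i, u (S.q i) = 0) {x : K} (hx : x ∈ S.V m) : u x = 0 := by
  rw [← h0 0]
  exact hS.const_of_energy_nonpos h hx (hS.V_zero_subset m (S.mem_V_zero.2 ⟨0, rfl⟩))

theorem eq_zero_of_forall_energy_nonpos (hS : S.IsD4Symmetric) {u : K → ℝ} (hu : Continuous u)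
    (h : ∀ m, S.energy m u ≤ 0) (h0 : ∀ i, u (S.q i) = 0) : u = 0 :=
  hS.ext_of_vertices hu continuous_const fun m _ hy => hS.eq_zero_of_energy_nonpos (h m) h0 hy

end IsD4Symmetric

/-! ### Self-similar integration -/

section Integral

variable {K : Type*} [MetricSpace K] [CompactSpace K] [MeasurableSpace K] [BorelSpace K]
  {S : FractalData K}

namespace IsD4Symmetric

theorem integrable (hS : S.IsD4Symmetric) {f : K → ℝ} (hf : Continuous f) :
    Integrable f S.μ := by
  have := hS.isProbabilityMeasure
  exact hf.integrable_of_hasCompactSupport (HasCompactSupport.of_compactSpace f)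

theorem integral_eq (hS : S.IsD4Symmetric) {f : K → ℝ} (hf : Continuous f) :
    ∫ x, f x ∂S.μ = ∑ k, S.p k * ∫ x, f (S.F k x) ∂S.μ := by
  have := hS.isProbabilityMeasure
  conv_lhs => rw [hS.selfSimilar]
  have hmap : ∀ k, IsProbabilityMeasure (S.μ.map (S.F k)) := fun k =>
    Measure.isProbabilityMeasure_map (hS.continuous_F k).measurable.aemeasurable
  rw [integral_finsetSum_measure]
  · refine Finset.sum_congr rfl fun k _ => ?_
    rw [integral_smul_measure, ENNReal.toReal_ofReal (hS.p_pos k).le, smul_eq_mul,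
      integral_map (hS.continuous_F k).measurable.aemeasurable hf.aestronglyMeasurable]
  · intro k _
    have := hmap k
    exact (hf.integrable_of_hasCompactSupport (HasCompactSupport.of_compactSpace f)).smul_measure
      ENNReal.ofReal_ne_top

theorem integral_eq_sum_word (hS : S.IsD4Symmetric) (m : ℕ) {f : K → ℝ} (hf : Continuous f) :
    ∫ x, f x ∂S.μ = ∑ w : S.Word m, S.pWord w * ∫ x, f (S.cellMap m w x) ∂S.μ := by
  induction m generalizing f with
  | zero => simp
  | succ m ih =>
    rw [hS.integral_eq hf]
    simp only [sum_word_succ, pWord_cons, cellMap_cons, mul_assoc, ← Finset.mul_sum]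
    exact Finset.sum_congr rfl fun k _ => congrArg _ (ih (hf.comp (hS.continuous_F k)))

end IsD4Symmetric

end Integral

end FractalData

/-! ### Gluing along cells and fixed points of self-similar recursions -/

namespace FractalData

namespace IsD4Symmetric

variable {K : Type*} [MetricSpace K] [CompactSpace K] [MeasurableSpace K] {S : FractalData K}

/-- Continuous functions on the cells of level one which agree at common corners define a
continuous function on `K`. -/
theorem exists_glue (hS : S.IsD4Symmetric) (g : Fin S.N → C(K, ℝ))
    (hg : ∀ k l i j, S.F k (S.q i) = S.F l (S.q j) → g k (S.q i) = g l (S.q j)) :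
    ∃ u : C(K, ℝ), ∀ k y, u (S.F k y) = g k y := by
  let π : Fin S.N × K → K := fun z => S.F z.1 z.2
  have hπ : Continuous π := continuous_prod_of_discrete_left.2 fun k => hS.continuous_F k
  have hsurj : Function.Surjective π := fun x => by
    have hx : x ∈ ⋃ l, Set.range (S.F l) := hS.cover ▸ Set.mem_univ x
    obtain ⟨k, y, rfl⟩ := Set.mem_iUnion.1 hx
    exact ⟨(k, y), rfl⟩
  -- The disjoint union of the cells is compact and `K` is Hausdorff, so continuity downstairs is
  -- continuity upstairs plus constancy on fibres.
  have hquot : IsQuotientMap π := hπ.isClosedMap.isQuotientMap hπ hsurj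
  have hfib : ∀ k l y z, S.F k y = S.F l z → g k y = g l z := by
    intro k l y z h
    by_cases hkl : k = l
    · subst hkl
      rw [hS.injective k h]
    · obtain ⟨⟨i, rfl⟩, ⟨j, rfl⟩, -⟩ := hS.eq_corner_of_F_eq hkl h
      exact hg k l i j h
  let G : C(Fin S.N × K, ℝ) :=
    ⟨fun z => g z.1 z.2, continuous_prod_of_discrete_left.2 fun k => (g k).continuous⟩
  have hG : ∀ a b, π a = π b → G a = G b := fun a b h => hfib a.1 b.1 a.2 b.2 h
  let P : C(Fin S.N × K, K) := ⟨π, hπ⟩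
  have hP : IsQuotientMap P := hquot
  refine ⟨hP.lift G hG, fun k y => ?_⟩
  exact congrArg (fun f : C(Fin S.N × K, ℝ) => f (k, y)) (hP.lift_comp G hG)

/-- Construction of families of continuous functions from a self-similar recursion. -/
theorem exists_selfSimilar_family (hS : S.IsD4Symmetric) {X : Type*} (T : Fin S.N → X → X)
    (c : Fin S.N → X → C(K, ℝ)) (U₀ : X → C(K, ℝ)) (β : X → Fin 4 → ℝ) (δ : X → ℝ) {θ : ℝ}
    (hθ0 : 0 ≤ θ) (hθ : θ < 1) (h0 : ∀ s i, U₀ s (S.q i) = β s i)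
    (hc : ∀ s k l i j, S.F k (S.q i) = S.F l (S.q j) →
      c k s (S.q i) + β (T k s) i = c l s (S.q j) + β (T l s) j)
    (hb : ∀ s i, c (S.idx i) s (S.q i) + β (T (S.idx i) s) i = β s i)
    (hstep : ∀ s k y, |c k s y + U₀ (T k s) y - U₀ s (S.F k y)| ≤ δ s)
    (hδ : ∀ s k, δ (T k s) ≤ θ * δ s) :
    ∃ U : X → C(K, ℝ), (∀ s i, U s (S.q i) = β s i) ∧
      ∀ s k y, U s (S.F k y) = c k s y + U (T k s) y := by
  have hnext : ∀ U : X → C(K, ℝ), (∀ s i, U s (S.q i) = β s i) → ∃ U' : X → C(K, ℝ),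
      (∀ s i, U' s (S.q i) = β s i) ∧ ∀ s k y, U' s (S.F k y) = c k s y + U (T k s) y := by
    intro U hU
    have := fun s => hS.exists_glue (fun k => c k s + U (T k s)) (by
      intro k l i j h
      simp only [ContinuousMap.add_apply, hU]
      exact hc s k l i j h)
    choose U' hU' using this
    refine ⟨U', fun s i => ?_, hU'⟩
    have h1 := hU' s (S.idx i) (S.q i)
    rw [hS.fixed] at h1
    rw [h1, ContinuousMap.add_apply, hU, hb]
  choose Φ hΦ using fun U : {U : X → C(K, ℝ) // ∀ s i, U s (S.q i) = β s i} => hnext U.1 U.2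
  -- The whole family is iterated at once, since member `s` on cell `k` is read off from member `T k
  -- s`. Keeping the boundary values `β` in the type guarantees that every iterate can be glued
  -- again.
  let A : ℕ → {U : X → C(K, ℝ) // ∀ s i, U s (S.q i) = β s i} := fun n =>
    Nat.rec ⟨U₀, h0⟩ (fun _ U => ⟨Φ U, (hΦ U).1⟩) n
  have hA : ∀ n s k y, (A (n + 1)).1 s (S.F k y) = c k s y + (A n).1 (T k s) y :=
    fun n => (hΦ (A n)).2
  have hδ0 : ∀ s, 0 ≤ δ s := fun s => (abs_nonneg _).trans (hstep s (S.idx 0) (S.q 0))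
  have hpt : ∀ n s x, |(A (n + 1)).1 s x - (A n).1 s x| ≤ δ s * θ ^ n := by
    intro n
    induction n with
    | zero =>
      intro s x
      obtain ⟨w, y, rfl⟩ := hS.exists_cell 1 x
      change |(A (0 + 1)).1 s (S.F (w 0) y) - U₀ s (S.F (w 0) y)| ≤ _
      rw [hA, pow_zero, mul_one]
      exact hstep s (w 0) y
    | succ n ih =>
      intro s x
      obtain ⟨w, y, rfl⟩ := hS.exists_cell 1 x
      change |(A (n + 1 + 1)).1 s (S.F (w 0) y) - (A (n + 1)).1 s (S.F (w 0) y)| ≤ _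
      rw [hA (n + 1), hA n, add_sub_add_left_eq_sub]
      refine (ih _ y).trans ?_
      rw [pow_succ', ← mul_assoc, mul_comm (δ s)]
      exact mul_le_mul_of_nonneg_right (hδ s (w 0)) (pow_nonneg hθ0 n)
  have hcs : ∀ s, CauchySeq fun n => (A n).1 s := fun s => by
    refine cauchySeq_of_le_geometric θ (δ s) hθ fun n => ?_
    rw [dist_comm, ContinuousMap.dist_le]
    · intro x
      rw [Real.dist_eq]
      exact hpt n s x
    · exact mul_nonneg (hδ0 s) (pow_nonneg hθ0 n)
  choose U hU using fun s => cauchySeq_tendsto_of_complete (hcs s)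
  have hUx : ∀ s x, Tendsto (fun n => (A n).1 s x) atTop (𝓝 (U s x)) := fun s x =>
    ((continuous_eval_const x).tendsto _).comp (hU s)
  refine ⟨U, fun s i => ?_, fun s k y => ?_⟩
  · refine tendsto_nhds_unique (hUx s (S.q i)) ?_
    simp only [(A _).2 s i]
    exact tendsto_const_nhds
  · refine tendsto_nhds_unique ((tendsto_add_atTop_iff_nat 1).2 (hUx s (S.F k y))) ?_
    simp only [hA]
    exact (hUx (T k s) y).const_add _

end IsD4Symmetric

end FractalData

/-! ### Harmonic extension and the Green function of level one -/

namespace FractalData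

/-- The energy of values on the four boundary points. -/
def cornerEnergy (a : Fin 4 → ℝ) : ℝ := ∑ i, a i * (4 * a i - ∑ j, a j)

/-- The energy is the sum of all six squared differences. Its square root thus controls the
oscillation of boundary values, which is how the harmonic recursion is shown to converge. -/
theorem sq_sub_le_cornerEnergy (a : Fin 4 → ℝ) (i : Fin 4) : (a i - a 0) ^ 2 ≤ cornerEnergy a := by
  have h : cornerEnergy a = (a 0 - a 1) ^ 2 + (a 0 - a 2) ^ 2 + (a 0 - a 3) ^ 2 +
      (a 1 - a 2) ^ 2 + (a 1 - a 3) ^ 2 + (a 2 - a 3) ^ 2 := by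
    simp only [cornerEnergy, Fin.sum_univ_four]
    ring
  rw [h]
  fin_cases i <;> simp <;>
    nlinarith [sq_nonneg (a 0 - a 1), sq_nonneg (a 0 - a 2), sq_nonneg (a 0 - a 3),
      sq_nonneg (a 1 - a 2), sq_nonneg (a 1 - a 3), sq_nonneg (a 2 - a 3)]

theorem cornerEnergy_nonneg (a : Fin 4 → ℝ) : 0 ≤ cornerEnergy a :=
  (sq_nonneg _).trans (sq_sub_le_cornerEnergy a 0)

theorem abs_sub_le_sqrt_cornerEnergy (a : Fin 4 → ℝ) (i : Fin 4) :
    |a i - a 0| ≤ √(cornerEnergy a) :=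
  Real.abs_le_sqrt (sq_sub_le_cornerEnergy a i)

namespace IsD4Symmetric

variable {K : Type*} [MetricSpace K] [MeasurableSpace K] {S : FractalData K}

/-- Pythagoras: a minimizer `v'` with the same boundary values has energy `E_1(v) + E_1(v' - v)`, so
`v` is itself minimal. -/
theorem energy_one_eq_of_form_eq_zero (hS : S.IsD4Symmetric) {v : K → ℝ}
    (h : ∀ φ : K → ℝ, (∀ i, φ (S.q i) = 0) → S.form 1 v φ = 0) :
    S.energy 1 v = S.energy 0 v := by
  refine le_antisymm ?_ (hS.energy_zero_le_one v)
  obtain ⟨v', hv', he⟩ := (hS.harmonicStructure v).1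
  have h1 := S.energy_add 1 v (v' - v)
  rw [h (v' - v) fun i => sub_eq_zero.2 (hv' _ (S.mem_V_zero.2 ⟨i, rfl⟩)),
    add_sub_cancel] at h1
  have h2 := hS.energy_nonneg 1 (v' - v)
  linarith

/-- The harmonic extension from `V_0` to `V_1`. -/
theorem exists_harmonic_extension_one (hS : S.IsD4Symmetric) (a : Fin 4 → ℝ) :
    ∃ v : K → ℝ, (∀ i, v (S.q i) = a i) ∧
      ∀ φ : K → ℝ, (∀ i, φ (S.q i) = 0) → S.form 1 v φ = 0 := by
  set u : K → ℝ := Function.extend S.q a 0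
  have hu : ∀ i, u (S.q i) = a i := fun i => hS.q_injective.extend_apply a 0 i
  obtain ⟨v, hv, he⟩ := (hS.harmonicStructure u).1
  refine ⟨v, fun i => (hv _ (S.mem_V_zero.2 ⟨i, rfl⟩)).trans (hu i), fun φ hφ => ?_⟩
  -- First variation at the minimizer: a quadratic in `t` that is nonnegative and has no constant
  -- term has vanishing linear coefficient, by its discriminant.
  have h1 : ∀ t : ℝ, 0 ≤ S.energy 1 φ * (t * t) + 2 * S.form 1 v φ * t + 0 := by
    intro t
    have h2 : S.energy 0 u ≤ S.energy 1 (v + t • φ) := by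
      refine (hS.harmonicStructure u).2 ⟨v + t • φ, fun y hy => ?_, rfl⟩
      obtain ⟨i, rfl⟩ := S.mem_V_zero.1 hy
      simp [hφ i, hv _ hy]
    have h3 : S.energy 1 (t • φ) = t * t * S.energy 1 φ := by
      rw [energy_eq_form, energy_eq_form, form_smul_left, form_smul_right]
      ring
    rw [energy_add, form_smul_right, h3, he] at h2
    linarith
  have h4 := discrim_le_zero h1
  unfold discrim at h4
  have h5 : (2 * S.form 1 v φ) ^ 2 = 0 := le_antisymm (by linarith) (sq_nonneg _)
  have h6 := pow_eq_zero_iff two_ne_zero |>.1 h5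
  linarith

/-- By orthogonality `φ` may be replaced by the harmonic extension of its boundary values; the claim
is then the polarization of the equality of energies for `v`, `w` and `v + w`. -/
theorem form_one_eq_form_zero (hS : S.IsD4Symmetric) {v : K → ℝ}
    (h : ∀ φ : K → ℝ, (∀ i, φ (S.q i) = 0) → S.form 1 v φ = 0) (φ : K → ℝ) :
    S.form 1 v φ = S.form 0 v φ := by
  obtain ⟨w, hw, hw'⟩ := hS.exists_harmonic_extension_one fun i => φ (S.q i)
  have h1 : S.form 1 v φ = S.form 1 v w := by
    have := h (φ - w) fun i => by simp [hw]
    rw [form_sub_right] at this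
    linarith
  have h2 : S.form 0 v φ = S.form 0 v w := by
    refine S.form_congr (fun _ _ => rfl) fun y hy => ?_
    obtain ⟨i, rfl⟩ := S.mem_V_zero.1 hy
    exact (hw i).symm
  have e1 := hS.energy_one_eq_of_form_eq_zero h
  have e2 := hS.energy_one_eq_of_form_eq_zero hw'
  have e3 := hS.energy_one_eq_of_form_eq_zero (v := v + w) fun φ hφ => by
    rw [form_add_left, h φ hφ, hw' φ hφ, add_zero]
  rw [energy_add, energy_add] at e3
  rw [h1, h2]
  linarith

variable [CompactSpace K] [ConnectedSpace K]

open Classical in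
/-- The Green function of level one. -/
theorem exists_green_one (hS : S.IsD4Symmetric) {y : K} (hy : y ∈ S.V 1) :
    ∃ g : K → ℝ, (∀ i, g (S.q i) = 0) ∧
      ∀ φ : K → ℝ, (∀ i, φ (S.q i) = 0) → S.form 1 g φ = φ y := by
  by_cases hy0 : y ∈ S.V 0
  · obtain ⟨i, rfl⟩ := S.mem_V_zero.1 hy0
    exact ⟨0, fun _ => rfl, fun φ hφ => by simp [form, hφ i]⟩
  have : Finite (S.V 1 \ S.V 0 : Set K) := (S.V_finite 1).sdiff
  have : Fintype (S.V 1 \ S.V 0 : Set K) := Fintype.ofFinite _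
  let e : (S.V 1 \ S.V 0 : Set K) → K → ℝ := fun z x => if x = z then 1 else 0
  let ext : ((S.V 1 \ S.V 0 : Set K) → ℝ) → K → ℝ := fun v => ∑ z, v z • e z
  -- Gram matrix of the indicators of interior vertices. It is injective because zero energy and
  -- zero boundary values force zero on `V_1`, hence surjective by finiteness; the Green function is
  -- a preimage of the unit vector at `y`.
  let M : Matrix (S.V 1 \ S.V 0 : Set K) (S.V 1 \ S.V 0 : Set K) ℝ :=
    fun z z' => S.form 1 (e z') (e z)
  have hext : ∀ v (z : (S.V 1 \ S.V 0 : Set K)), ext v z = v z := by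
    intro v z
    simp only [ext, e, Finset.sum_apply, Pi.smul_apply, smul_eq_mul, mul_ite, mul_one, mul_zero,
      Subtype.coe_inj, Finset.sum_ite_eq, Finset.mem_univ, if_true]
  have hext0 : ∀ v i, ext v (S.q i) = 0 := by
    intro v i
    simp only [ext, Finset.sum_apply, Pi.smul_apply, smul_eq_mul]
    refine Finset.sum_eq_zero fun z _ => ?_
    have : S.q i ≠ z := fun h => z.2.2 (h ▸ S.mem_V_zero.2 ⟨i, rfl⟩)
    simp [e, this]
  have hform : ∀ v (φ : K → ℝ), (∀ i, φ (S.q i) = 0) →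
      S.form 1 (ext v) φ = ∑ z : (S.V 1 \ S.V 0 : Set K), φ z * (M.mulVec v) z := by
    intro v φ hφ
    have h1 : S.form 1 (ext v) φ = S.form 1 (ext v) (ext fun z => φ z) := by
      refine S.form_congr (fun _ _ => rfl) fun x hx => ?_
      by_cases hx0 : x ∈ S.V 0
      · obtain ⟨i, rfl⟩ := S.mem_V_zero.1 hx0
        rw [hφ, hext0]
      · exact (hext (fun z => φ z) ⟨x, hx, hx0⟩).symm
    rw [h1, form_comm]
    simp only [ext]
    rw [form_sum_left]
    refine Finset.sum_congr rfl fun z _ => ?_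
    rw [form_smul_left, form_comm, form_sum_left]
    congr 1
    refine Finset.sum_congr rfl fun z' _ => ?_
    rw [form_smul_left, mul_comm]
  have hinj : Function.Injective M.mulVec := by
    intro v v' hvv
    have h1 : M.mulVec (v - v') = 0 := by rw [Matrix.mulVec_sub, hvv, sub_self]
    have h2 : S.energy 1 (ext (v - v')) ≤ 0 := by
      rw [energy_eq_form, hform _ _ (hext0 _), h1]
      simp
    funext z
    have h3 := hS.eq_zero_of_energy_nonpos h2 (hext0 _) z.2.1
    rw [hext] at h3
    exact sub_eq_zero.1 h3
  obtain ⟨v, hv⟩ := (Matrix.mulVec_surjective_iff_isUnit.2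
    (Matrix.mulVec_injective_iff_isUnit.1 hinj)) (Pi.single ⟨y, hy, hy0⟩ 1)
  refine ⟨ext v, hext0 v, fun φ hφ => ?_⟩
  rw [hform v φ hφ, hv]
  simp [Pi.single_apply]

/-- A function that is orthogonal to all functions vanishing on `V_0` is determined by its values
on `V_0`. -/
theorem eq_of_harmonic (hS : S.IsD4Symmetric) {u v : K → ℝ} (hu : Continuous u)
    (hv : Continuous v) (hu' : ∀ m φ, S.form m u φ = S.form 0 u φ)
    (hv' : ∀ m φ, S.form m v φ = S.form 0 v φ) (h : ∀ i, u (S.q i) = v (S.q i)) : u = v := by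
  have h0 : ∀ i, (u - v) (S.q i) = 0 := fun i => sub_eq_zero.2 (h i)
  refine sub_eq_zero.1 (hS.eq_zero_of_forall_energy_nonpos (hu.sub hv) (fun m => ?_) h0)
  rw [energy_eq_form, form_sub_left, hu', hv', ← form_sub_left, form_zero]
  simp only [h0]
  simp

/-- Harmonic extension to `K`. -/
theorem exists_harmonic_extension (hS : S.IsD4Symmetric) :
    ∃ U : (Fin 4 → ℝ) → C(K, ℝ), (∀ a i, U a (S.q i) = a i) ∧
      (∀ a k y, U a (S.F k y) = U (fun j => U a (S.F k (S.q j))) y) ∧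
      ∀ a m φ, S.form m (U a) φ = S.form 0 (U a) φ := by
  choose v hv hv' using fun i : Fin 4 => hS.exists_harmonic_extension_one (Pi.single i 1)
  let V : (Fin 4 → ℝ) → K → ℝ := fun a => ∑ i, a i • v i
  have hVx : ∀ a x, V a x = ∑ i, a i * v i x := fun a x => by simp [V]
  have hVq : ∀ a i, V a (S.q i) = a i := by
    intro a i
    rw [hVx]
    simp [hv, Pi.single_apply]
  have hVf : ∀ a φ, S.form 1 (V a) φ = S.form 0 (V a) φ := by
    intro a φ
    refine hS.form_one_eq_form_zero (fun φ hφ => ?_) φ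
    simp only [V]
    rw [form_sum_left]
    exact Finset.sum_eq_zero fun i _ => by rw [form_smul_left, hv' i φ hφ, mul_zero]
  have hV1 : ∀ x ∈ S.V 1, ∑ i, v i x = 1 := by
    intro x hx
    have h0 : ∀ i, (V (fun _ => 1) - (fun _ => 1 : K → ℝ)) (S.q i) = 0 := fun i => by
      simp only [Pi.sub_apply, hVq, sub_self]
    have h1 : S.energy 1 (V (fun _ => 1) - (fun _ => 1 : K → ℝ)) ≤ 0 := by
      rw [energy_eq_form, form_sub_left, form_one_left, hVf, form_zero]
      simp only [h0]
      simp
    have h2 := hS.eq_zero_of_energy_nonpos h1 h0 hx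
    simp only [Pi.sub_apply, hVx, one_mul] at h2
    linarith
  -- The extension matrix of cell `k`: the harmonic function with boundary values `a` must restrict
  -- on that cell to the one with boundary values `T k a`.
  let T : Fin S.N → (Fin 4 → ℝ) → Fin 4 → ℝ := fun k a j => V a (S.F k (S.q j))
  have hmem : ∀ k j, S.F k (S.q j) ∈ S.V 1 := fun k j =>
    S.mem_V_succ.2 ⟨k, S.q j, S.mem_V_zero.2 ⟨j, rfl⟩, rfl⟩
  -- The energies of the cells, weighted by `r_k⁻¹`, add up to the initial energy, so each is at
  -- most the whole. With `r_k < 1` this gives the contraction of the recursion.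
  have hTE : ∀ k a, cornerEnergy (T k a) ≤ S.r k * cornerEnergy a := by
    intro k a
    have h1 : cornerEnergy a = ∑ k, (S.r k)⁻¹ * cornerEnergy (T k a) := by
      have h2 : cornerEnergy a = S.form 0 (V a) (V a) := by
        rw [form_zero]; simp only [hVq]; rfl
      rw [h2, ← hVf, form_one]
      refine Finset.sum_congr rfl fun k _ => ?_
      rw [form_zero]
      rfl
    have h2 : (S.r k)⁻¹ * cornerEnergy (T k a) ≤ cornerEnergy a := by
      rw [h1]
      exact Finset.single_le_sum (f := fun k => (S.r k)⁻¹ * cornerEnergy (T k a))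
        (fun k _ => mul_nonneg (inv_nonneg.2 (hS.r_pos k).le) (cornerEnergy_nonneg _))
        (Finset.mem_univ k)
    rwa [inv_mul_le_iff₀ (hS.r_pos k)] at h2
  let B : ℝ := ∑ k, ∑ j, ∑ i, |v i (S.F k (S.q j))|
  have hB : ∀ a k j, |T k a j - a 0| ≤ B * √(cornerEnergy a) := by
    intro a k j
    have h1 : T k a j - a 0 = ∑ i, (a i - a 0) * v i (S.F k (S.q j)) := by
      simp only [T, hVx, sub_mul, Finset.sum_sub_distrib]
      rw [← Finset.mul_sum, hV1 _ (hmem k j), mul_one]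
    rw [h1]
    calc |∑ i, (a i - a 0) * v i (S.F k (S.q j))|
        ≤ ∑ i, |(a i - a 0) * v i (S.F k (S.q j))| := Finset.abs_sum_le_sum_abs _ _
      _ ≤ ∑ i, |v i (S.F k (S.q j))| * √(cornerEnergy a) := by
          refine Finset.sum_le_sum fun i _ => ?_
          rw [abs_mul, mul_comm]
          exact mul_le_mul_of_nonneg_left (abs_sub_le_sqrt_cornerEnergy a i) (abs_nonneg _)
      _ = (∑ i, |v i (S.F k (S.q j))|) * √(cornerEnergy a) := by rw [Finset.sum_mul]
      _ ≤ B * √(cornerEnergy a) := by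
          refine mul_le_mul_of_nonneg_right ?_ (Real.sqrt_nonneg _)
          refine (Finset.single_le_sum (f := fun j => ∑ i, |v i (S.F k (S.q j))|)
            (fun j _ => Finset.sum_nonneg fun i _ => abs_nonneg _) (Finset.mem_univ j)).trans ?_
          exact Finset.single_le_sum (f := fun k => ∑ j, ∑ i, |v i (S.F k (S.q j))|)
            (fun k _ => Finset.sum_nonneg fun j _ => Finset.sum_nonneg fun i _ => abs_nonneg _)
            (Finset.mem_univ k)
  -- Any continuous functions separating the boundary points serve to start the iteration; products
  -- of distances are an explicit choice.
  have hlag : ∃ L : Fin 4 → C(K, ℝ), ∀ i j, L i (S.q j) = if i = j then 1 else 0 := by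
    refine ⟨fun i => ⟨fun x => ∏ j ∈ Finset.univ.erase i,
      dist x (S.q j) / dist (S.q i) (S.q j), by fun_prop⟩, fun i j => ?_⟩
    simp only [ContinuousMap.coe_mk]
    split_ifs with hij
    · subst hij
      refine Finset.prod_eq_one fun j hj => div_self ?_
      exact dist_ne_zero.2 fun h => (Finset.ne_of_mem_erase hj) (hS.q_injective h).symm
    · exact Finset.prod_eq_zero (Finset.mem_erase.2 ⟨fun h => hij h.symm, Finset.mem_univ j⟩)
        (by simp)
  obtain ⟨L, hL⟩ := hlag
  let U₀ : (Fin 4 → ℝ) → C(K, ℝ) := fun a =>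
    ContinuousMap.const K (a 0) + ∑ j, (a j - a 0) • L j
  have hU₀ : ∀ a x, U₀ a x = a 0 + ∑ j, (a j - a 0) * L j x := fun a x => by
    simp [U₀, ContinuousMap.sum_apply]
  let Λ : ℝ := ∑ j, ‖L j‖
  have hΛ0 : 0 ≤ Λ := Finset.sum_nonneg fun j _ => norm_nonneg _
  have hLsum : ∀ (b : Fin 4 → ℝ) (s : ℝ) (x : K), (∀ j, |b j| ≤ s) →
      |∑ j, b j * L j x| ≤ s * Λ := by
    intro b s x hb
    refine (Finset.abs_sum_le_sum_abs _ _).trans ?_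
    rw [Finset.mul_sum]
    refine Finset.sum_le_sum fun j _ => ?_
    rw [abs_mul]
    exact mul_le_mul (hb j) ((L j).norm_coe_le_norm x) (abs_nonneg _)
      ((abs_nonneg _).trans (hb j))
  have : Nonempty (Fin S.N) := ⟨S.idx 0⟩
  set R : ℝ := Finset.univ.sup' Finset.univ_nonempty S.r
  have hR : ∀ k, S.r k ≤ R := fun k => Finset.le_sup' S.r (Finset.mem_univ k)
  have hR1 : R < 1 := (Finset.sup'_lt_iff _).2 fun k _ => hS.r_lt_one k
  have hB0 : 0 ≤ B := Finset.sum_nonneg fun k _ => Finset.sum_nonneg fun j _ =>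
    Finset.sum_nonneg fun i _ => abs_nonneg _
  -- The three terms bound, in units of the root of the energy, the change of base value, the
  -- interpolation of `T k a` and the interpolation of `a`. The contraction ratio for the root of
  -- the energy is `√R`.
  set C : ℝ := B + 2 * B * Λ + Λ
  have hC0 : 0 ≤ C := by positivity
  obtain ⟨U, hUq, hUF⟩ := hS.exists_selfSimilar_family T (fun _ _ => 0) U₀ id
    (fun a => C * √(cornerEnergy a)) (Real.sqrt_nonneg R)
    ((Real.sqrt_lt' one_pos).2 (by simpa using hR1))
    (fun a i => by
      rw [hU₀]
      simp [hL])
    (fun a k l i j h => by simp [T, h])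
    (fun a i => by simp [T, hS.fixed, hVq])
    (fun a k y => by
      rw [ContinuousMap.zero_apply, zero_add, hU₀, hU₀]
      have h0 := hB a k 0
      have h1 := hLsum (fun j => T k a j - T k a 0) (2 * (B * √(cornerEnergy a))) y fun j => by
        have := abs_sub_le (T k a j) (a 0) (T k a 0)
        have h3 := hB a k j
        rw [abs_sub_comm (a 0)] at this
        linarith
      have h2 := hLsum (fun j => a j - a 0) (√(cornerEnergy a)) (S.F k y)
        (abs_sub_le_sqrt_cornerEnergy a)
      rw [abs_le] at h0 h1 h2 ⊢
      simp only [C]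
      constructor <;> linarith [h0.1, h1.1, h2.1, h0.2, h1.2, h2.2])
    (fun a k => by
      rw [mul_left_comm]
      refine mul_le_mul_of_nonneg_left ?_ hC0
      rw [← Real.sqrt_mul ((hS.r_pos k).le.trans (hR k))]
      exact Real.sqrt_le_sqrt ((hTE k a).trans
        (mul_le_mul_of_nonneg_right (hR k) (cornerEnergy_nonneg a))))
  simp only [ContinuousMap.zero_apply, zero_add, id] at hUF hUq
  refine ⟨U, hUq, fun a k y => ?_, fun a m => ?_⟩
  · rw [hUF]
    congr 2
    funext j
    rw [hUF, hUq]
  · induction m generalizing a with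
    | zero => exact fun _ => rfl
    | succ m ih =>
      intro φ
      have h1 : S.form 0 (U a) φ = S.form 0 (V a) φ := by
        simp only [form_zero, hUq, hVq]
      rw [h1, ← hVf, form_one, form_succ]
      refine Finset.sum_congr rfl fun k _ => ?_
      have h2 : (U a : K → ℝ) ∘ S.F k = U (T k a) := funext fun y => hUF a k y
      rw [h2, ih]
      simp only [form_zero, hUq]
      rfl

end IsD4Symmetric

end FractalData

/-! ### The weak equation and the harmonic basis -/

namespace FractalData

section Pairing

variable {K : Type*} [MeasurableSpace K] (S : FractalData K)

/-- The discrete approximation of `∫ f φ dμ` in which `φ` is replaced by the piecewise harmonic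
spline of level `m` with the same values on `V_m`. -/
noncomputable def pairing (h : Fin 4 → K → ℝ) (m : ℕ) (f φ : K → ℝ) : ℝ :=
  ∑ w : S.Word m, S.pWord w * ∑ i, φ (S.cellMap m w (S.q i)) *
    ∫ x, h i x * f (S.cellMap m w x) ∂S.μ

/-- The weak formulation of `Δ u = f`. -/
def IsWeakSolution (h : Fin 4 → K → ℝ) (u f : K → ℝ) : Prop :=
  ∀ m φ, S.form m u φ + S.pairing h m f φ = S.form 0 u φ + S.pairing h 0 f φ

variable (h : Fin 4 → K → ℝ)

theorem pairing_zero (f φ : K → ℝ) :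
    S.pairing h 0 f φ = ∑ i, φ (S.q i) * ∫ x, h i x * f x ∂S.μ := by
  simp [pairing]

theorem pairing_succ (m : ℕ) (f φ : K → ℝ) :
    S.pairing h (m + 1) f φ = ∑ k, S.p k * S.pairing h m (f ∘ S.F k) (φ ∘ S.F k) := by
  simp only [pairing, sum_word_succ, cellMap_cons, pWord_cons, Finset.mul_sum,
    Function.comp_apply, mul_assoc]

theorem pairing_one (f φ : K → ℝ) :
    S.pairing h 1 f φ = ∑ k, S.p k * S.pairing h 0 (f ∘ S.F k) (φ ∘ S.F k) :=
  S.pairing_succ h 0 f φ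

theorem pairing_smul_left (m : ℕ) (c : ℝ) (f φ : K → ℝ) :
    S.pairing h m (c • f) φ = c * S.pairing h m f φ := by
  simp only [pairing, Pi.smul_apply, smul_eq_mul, mul_left_comm _ c, integral_const_mul,
    Finset.mul_sum]

theorem pairing_add_right (m : ℕ) (f φ ψ : K → ℝ) :
    S.pairing h m f (φ + ψ) = S.pairing h m f φ + S.pairing h m f ψ := by
  simp only [pairing, Pi.add_apply, add_mul, Finset.sum_add_distrib, mul_add]

theorem pairing_congr {m : ℕ} {φ ψ : K → ℝ} (f : K → ℝ) (hφ : ∀ y ∈ S.V m, φ y = ψ y) :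
    S.pairing h m f φ = S.pairing h m f ψ := by
  have h2 : ∀ (w : S.Word m) i, φ (S.cellMap m w (S.q i)) = ψ (S.cellMap m w (S.q i)) :=
    fun w i => hφ _ ⟨w, i, rfl⟩
  simp only [pairing, h2]

theorem IsWeakSolution.smul {h : Fin 4 → K → ℝ} {S : FractalData K} {u f : K → ℝ} (hu : S.IsWeakSolution h u f) (c : ℝ) :
    S.IsWeakSolution h (c • u) (c • f) := fun m φ => by
  simp only [form_smul_left, pairing_smul_left, ← mul_add, hu m φ]

open Classical in
/-- The weak formulation, localized at a vertex. -/
theorem IsWeakSolution.graphLaplacian_eq {h : Fin 4 → K → ℝ} {S : FractalData K} {u f : K → ℝ}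
    (hu : S.IsWeakSolution h u f) {m : ℕ} {x : K} (hx : x ∉ S.V 0) :
    S.graphLaplacian m u x = ∑ w, ∑ i, if S.cellMap m w (S.q i) = x then
      S.pWord w * ∫ y, h i y * f (S.cellMap m w y) ∂S.μ else 0 := by
  have h1 := hu m fun y => if y = x then 1 else 0
  have h0 : ∀ i, S.q i ≠ x := fun i e => hx (S.mem_V_zero.2 ⟨i, e⟩)
  rw [form_indicator, form_zero, pairing_zero] at h1
  simp only [h0, if_false, zero_mul, Finset.sum_const_zero, add_zero, pairing] at h1
  rw [neg_add_eq_zero.1 h1]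
  refine Finset.sum_congr rfl fun w _ => ?_
  rw [Finset.mul_sum]
  exact Finset.sum_congr rfl fun i _ => by split_ifs <;> ring

end Pairing

/-- The harmonic functions with boundary values `δ_i`. -/
structure IsHarmonicBasis {K : Type*} [MeasurableSpace K] [TopologicalSpace K]
    (S : FractalData K) (h : Fin 4 → K → ℝ) : Prop where
  continuous : ∀ i, Continuous (h i)
  apply_q : ∀ i j, h i (S.q j) = if i = j then 1 else 0
  form_eq : ∀ i m φ, S.form m (h i) φ = S.form 0 (h i) φ
  apply_F : ∀ i k y, h i (S.F k y) = ∑ j, h i (S.F k (S.q j)) * h j y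

variable {K : Type*} [MetricSpace K] [MeasurableSpace K] {S : FractalData K}

namespace IsHarmonicBasis

variable {h : Fin 4 → K → ℝ} (hh : S.IsHarmonicBasis h)
include hh

theorem continuous_sum (a : Fin 4 → ℝ) : Continuous (∑ i, a i • h i) := by
  have := hh.continuous
  have e : (∑ i, a i • h i) = fun x => ∑ i, a i * h i x := by funext x; simp
  rw [e]
  fun_prop

theorem sum_apply_q (a : Fin 4 → ℝ) (j : Fin 4) : (∑ i, a i • h i) (S.q j) = a j := by
  simp [hh.apply_q]

theorem form_sum_eq (a : Fin 4 → ℝ) (m : ℕ) (φ : K → ℝ) :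
    S.form m (∑ i, a i • h i) φ = S.form 0 (∑ i, a i • h i) φ := by
  simp only [form_sum_left, form_smul_left, hh.form_eq _ m]

theorem sum_apply_F (a : Fin 4 → ℝ) (k : Fin S.N) (y : K) :
    (∑ i, a i • h i) (S.F k y) = ∑ j, (∑ i, a i • h i) (S.F k (S.q j)) * h j y := by
  simp only [Finset.sum_apply, Pi.smul_apply, smul_eq_mul, hh.apply_F _ k y, Finset.mul_sum,
    Finset.sum_mul]
  rw [Finset.sum_comm]
  simp only [mul_assoc]

end IsHarmonicBasis

/-! ### Spline pairings and the Dirichlet problem -/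

namespace IsD4Symmetric

variable [CompactSpace K]

section

variable [BorelSpace K] {h : Fin 4 → K → ℝ}

theorem sum_mul_integral (hS : S.IsD4Symmetric) (hh : S.IsHarmonicBasis h) (b : Fin 4 → ℝ)
    {g : K → ℝ} (hg : Continuous g) :
    ∑ i, b i * ∫ x, h i x * g x ∂S.μ = ∫ x, (∑ i, b i * h i x) * g x ∂S.μ := by
  simp only [Finset.sum_mul, mul_assoc]
  rw [integral_finsetSum (f := fun i x => b i * (h i x * g x)) _ fun i _ =>
    (hS.integrable ((hh.continuous i).mul hg)).const_mul (b i)]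
  simp only [integral_const_mul]

theorem pairing_add_left (hS : S.IsD4Symmetric) (hh : S.IsHarmonicBasis h) (m : ℕ)
    {f g : K → ℝ} (hf : Continuous f) (hg : Continuous g) (φ : K → ℝ) :
    S.pairing h m (f + g) φ = S.pairing h m f φ + S.pairing h m g φ := by
  have h1 : ∀ (w : S.Word m) i, ∫ x, h i x * (f + g) (S.cellMap m w x) ∂S.μ =
      (∫ x, h i x * f (S.cellMap m w x) ∂S.μ) + ∫ x, h i x * g (S.cellMap m w x) ∂S.μ := by
    intro w i
    simp only [Pi.add_apply, mul_add]
    exact integral_add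
      (hS.integrable ((hh.continuous i).mul (hf.comp (hS.continuous_cellMap m w))))
      (hS.integrable ((hh.continuous i).mul (hg.comp (hS.continuous_cellMap m w))))
  simp only [pairing, h1, mul_add, Finset.sum_add_distrib]

/-- A harmonic function equals its own interpolating spline at levels 0 and 1, so both sides are its
integral against `f`. -/
theorem pairing_harmonic (hS : S.IsD4Symmetric) (hh : S.IsHarmonicBasis h) {f : K → ℝ}
    (hf : Continuous f) (a : Fin 4 → ℝ) :
    S.pairing h 1 f (∑ i, a i • h i) = S.pairing h 0 f (∑ i, a i • h i) := by
  have h0 : S.pairing h 0 f (∑ i, a i • h i) = ∫ x, (∑ i, a i • h i) x * f x ∂S.μ := by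
    rw [pairing_zero, hS.sum_mul_integral hh _ hf]
    simp only [hh.sum_apply_q]
    simp
  rw [h0, hS.integral_eq (f := fun x => (∑ i, a i • h i) x * f x) ((hh.continuous_sum a).mul hf),
    pairing_one]
  refine Finset.sum_congr rfl fun k _ => ?_
  rw [pairing_zero, hS.sum_mul_integral hh _ (hf.comp (hS.continuous_F k))]
  simp only [Function.comp_apply, ← hh.sum_apply_F]

end

variable [ConnectedSpace K]

/-- The extension operator obtained as a limit is not linear by construction; uniqueness of harmonic
functions makes it so, and the basis inherits the refinement rule. -/
theorem exists_harmonicBasis (hS : S.IsD4Symmetric) : ∃ h, S.IsHarmonicBasis h := by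
  obtain ⟨U, hUq, hUF, hUf⟩ := hS.exists_harmonic_extension
  have hsum : ∀ a, (U a : K → ℝ) = ∑ i, a i • (U (Pi.single i 1) : K → ℝ) := by
    intro a
    refine hS.eq_of_harmonic (U a).continuous ?_ (hUf a) (fun m φ => ?_) fun i => ?_
    · have e : (∑ i, a i • (U (Pi.single i 1) : K → ℝ)) =
          fun x => ∑ i, a i * U (Pi.single i 1) x := by funext x; simp
      rw [e]
      fun_prop
    · simp only [form_sum_left, form_smul_left, hUf _ m]
    · simp [hUq, Pi.single_apply]
  refine ⟨fun i => U (Pi.single i 1), fun i => (U _).continuous, fun i j => ?_,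
    fun i => hUf _, fun i k y => ?_⟩
  · simp [hUq, Pi.single_apply, eq_comm]
  · rw [hUF, hsum]
    simp

theorem eq_sum_harmonicBasis (hS : S.IsD4Symmetric) {h : Fin 4 → K → ℝ}
    (hh : S.IsHarmonicBasis h) {u : K → ℝ} (hu : Continuous u)
    (hu' : ∀ m φ, S.form m u φ = S.form 0 u φ) : u = ∑ i, u (S.q i) • h i :=
  hS.eq_of_harmonic hu (hh.continuous_sum _) hu' (hh.form_sum_eq _) fun i =>
    (hh.sum_apply_q (fun i => u (S.q i)) i).symm

theorem sum_harmonicBasis (hS : S.IsD4Symmetric) {h : Fin 4 → K → ℝ}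
    (hh : S.IsHarmonicBasis h) (x : K) : ∑ i, h i x = 1 := by
  have e := hS.eq_sum_harmonicBasis hh (u := fun _ => 1) continuous_const
    fun m φ => by rw [form_one_left, form_one_left]
  have := congrFun e x
  simpa using this.symm

variable [BorelSpace K] {h : Fin 4 → K → ℝ}

/-- Solution of the Dirichlet problem `Δ u = f`, `u = 0` on `V_0`. -/
theorem exists_weakSolution (hS : S.IsD4Symmetric) (hh : S.IsHarmonicBasis h) :
    ∃ G : C(K, ℝ) → C(K, ℝ), (∀ f i, G f (S.q i) = 0) ∧ ∀ f, S.IsWeakSolution h (G f) f := by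
  have hmem : ∀ k j, S.F k (S.q j) ∈ S.V 1 := fun k j =>
    S.mem_V_succ.2 ⟨k, S.q j, S.mem_V_zero.2 ⟨j, rfl⟩, rfl⟩
  choose g hg0 hg using fun k i => hS.exists_green_one (hmem k i)
  let h' : Fin 4 → C(K, ℝ) := fun i => ⟨h i, hh.continuous i⟩
  let J : C(K, ℝ) → Fin S.N → Fin 4 → ℝ := fun f k i => S.p k * ∫ x, h i x * f (S.F k x) ∂S.μ
  -- The solution of the weak equation at level one, superposed from Green functions: `J f k i` is
  -- the coefficient of `φ (F_k q_i)` in the pairing.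
  let v : C(K, ℝ) → K → ℝ := fun f => ∑ k, ∑ i, (-J f k i) • g k i
  have hvx : ∀ f x, v f x = ∑ k, ∑ i, -J f k i * g k i x := fun f x => by simp [v]
  have hv0 : ∀ f i, v f (S.q i) = 0 := fun f i => by simp [hvx, hg0]
  have hv : ∀ f (φ : K → ℝ), (∀ i, φ (S.q i) = 0) → S.form 1 (v f) φ + S.pairing h 1 f φ = 0 := by
    intro f φ hφ
    simp only [v, form_sum_left, form_smul_left, hg _ _ φ hφ, pairing_one, pairing_zero,
      Finset.mul_sum, ← Finset.sum_add_distrib]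
    refine Finset.sum_eq_zero fun k _ => Finset.sum_eq_zero fun i _ => ?_
    simp only [J, Function.comp_apply]
    ring
  let c : Fin S.N → C(K, ℝ) → C(K, ℝ) := fun k f => ∑ j, v f (S.F k (S.q j)) • h' j
  have hcx : ∀ k f, (c k f : K → ℝ) = ∑ j, v f (S.F k (S.q j)) • h j := fun k f => by
    funext x; simp [c, h', ContinuousMap.sum_apply]
  have hcq : ∀ k f j, c k f (S.q j) = v f (S.F k (S.q j)) := fun k f j => by
    rw [hcx, hh.sum_apply_q]
  -- On cell `k` the solution is the harmonic function `c k f` with the corner values found at level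
  -- one, plus the Dirichlet solution for the rescaled right side `r_k μ_k f ∘ F_k`. The factor `ρ <
  -- 1` makes this recursion contract.
  let T : Fin S.N → C(K, ℝ) → C(K, ℝ) := fun k f => S.ρ • f.comp ⟨S.F k, hS.continuous_F k⟩
  have hTx : ∀ k f, (T k f : K → ℝ) = S.ρ • ((f : K → ℝ) ∘ S.F k) := fun k f => rfl
  have := hS.isProbabilityMeasure
  have hJ : ∀ f k i, |J f k i| ≤ S.p k * ‖h' i‖ * ‖f‖ := by
    intro f k i
    simp only [J, abs_mul, abs_of_pos (hS.p_pos k), mul_assoc]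
    refine mul_le_mul_of_nonneg_left ?_ (hS.p_pos k).le
    have := norm_integral_le_of_norm_le_const (μ := S.μ) (f := fun x => h i x * f (S.F k x))
      (C := ‖h' i‖ * ‖f‖) (Eventually.of_forall fun x => by
        rw [norm_mul]
        exact mul_le_mul ((h' i).norm_coe_le_norm x) (f.norm_coe_le_norm _) (norm_nonneg _)
          (norm_nonneg _))
    simpa using this
  let C : Fin S.N → ℝ := fun k =>
    ∑ j, (∑ k', ∑ i, S.p k' * ‖h' i‖ * |g k' i (S.F k (S.q j))|) * ‖h' j‖
  have hC0 : ∀ k, 0 ≤ C k := fun k => Finset.sum_nonneg fun j _ => mul_nonneg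
    (Finset.sum_nonneg fun k' _ => Finset.sum_nonneg fun i _ =>
      mul_nonneg (mul_nonneg (hS.p_pos _).le (norm_nonneg _)) (abs_nonneg _)) (norm_nonneg _)
  have hvb : ∀ f x, |v f x| ≤ (∑ k', ∑ i, S.p k' * ‖h' i‖ * |g k' i x|) * ‖f‖ := by
    intro f x
    rw [hvx]
    refine (Finset.abs_sum_le_sum_abs _ _).trans ?_
    rw [Finset.sum_mul]
    refine Finset.sum_le_sum fun k' _ => (Finset.abs_sum_le_sum_abs _ _).trans ?_
    rw [Finset.sum_mul]
    refine Finset.sum_le_sum fun i _ => ?_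
    rw [abs_mul, abs_neg, mul_right_comm]
    exact mul_le_mul_of_nonneg_right (hJ f k' i) (abs_nonneg _)
  have hcb : ∀ k f y, |c k f y| ≤ C k * ‖f‖ := by
    intro k f y
    have e : c k f y = ∑ j, v f (S.F k (S.q j)) * h j y := by rw [hcx]; simp
    rw [e]
    refine (Finset.abs_sum_le_sum_abs _ _).trans ?_
    rw [Finset.sum_mul]
    refine Finset.sum_le_sum fun j _ => ?_
    rw [abs_mul, mul_right_comm]
    exact mul_le_mul (hvb f _) ((h' j).norm_coe_le_norm y) (abs_nonneg _)
      ((abs_nonneg _).trans (hvb f _))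
  obtain ⟨G, hGq, hGF⟩ := hS.exists_selfSimilar_family T c (fun _ => 0) (fun _ _ => 0)
    (fun f => (∑ k, C k) * ‖f‖) hS.rho_pos.le hS.rho_lt_one (fun _ _ => rfl)
    (fun f k l i j e => by simp only [hcq, e])
    (fun f i => by simp only [hcq, hS.fixed, hv0, add_zero])
    (fun f k y => by
      simp only [ContinuousMap.zero_apply, add_zero, sub_zero]
      exact (hcb k f y).trans (mul_le_mul_of_nonneg_right
        (Finset.single_le_sum (fun k _ => hC0 k) (Finset.mem_univ k)) (norm_nonneg _)))
    (fun f k => by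
      rw [mul_left_comm]
      refine mul_le_mul_of_nonneg_left ?_ (Finset.sum_nonneg fun k _ => hC0 k)
      refine (ContinuousMap.norm_le _ (mul_nonneg hS.rho_pos.le (norm_nonneg _))).2 fun x => ?_
      have : T k f x = S.ρ * f (S.F k x) := rfl
      rw [this, norm_mul, Real.norm_of_nonneg hS.rho_pos.le]
      exact mul_le_mul_of_nonneg_left (f.norm_coe_le_norm _) hS.rho_pos.le)
  refine ⟨G, hGq, fun f m => ?_⟩
  have hG1 : ∀ f φ, S.form 1 (G f) φ + S.pairing h 1 f φ =
      S.form 0 (G f) φ + S.pairing h 0 f φ := by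
    intro f φ
    have e1 : ∀ y ∈ S.V 1, G f y = v f y := by
      intro y hy
      obtain ⟨k, _, hz, rfl⟩ := S.mem_V_succ.1 hy
      obtain ⟨i, rfl⟩ := S.mem_V_zero.1 hz
      rw [hGF, hGq, hcq, add_zero]
    have e2 : ∀ ψ, S.form 0 (G f) ψ = 0 := by
      intro ψ
      rw [form_zero]
      simp only [hGq]
      simp
    -- Split `φ = (φ - H) + H`. The first part is covered by the construction of `v f`; for `H` the
    -- form vanishes since `v f` is zero on `V_0`, and the pairing does not change with the level.
    set H : K → ℝ := ∑ i, φ (S.q i) • h i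
    have hHq : ∀ i, H (S.q i) = φ (S.q i) := hh.sum_apply_q _
    have e3 := hv f (φ - H) fun i => by simp [hHq]
    have e4 : S.form 1 (v f) H = 0 := by
      rw [form_comm, hh.form_sum_eq, form_comm, form_zero]
      simp only [hv0]
      simp
    have e5 : S.pairing h 0 f φ = S.pairing h 0 f H := S.pairing_congr h f fun y hy => by
      obtain ⟨i, rfl⟩ := S.mem_V_zero.1 hy
      exact (hHq i).symm
    have e6 := S.form_add_right 1 (φ - H) H (v f)
    have e7 := S.pairing_add_right h 1 f (φ - H) H
    rw [sub_add_cancel] at e6 e7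
    rw [S.form_congr e1 fun _ _ => rfl, e2, e5, ← hS.pairing_harmonic hh f.continuous, e6, e7, e4]
    linarith
  induction m generalizing f with
  | zero => exact fun _ => rfl
  | succ m ih =>
    intro φ
    rw [← hG1, form_succ, pairing_succ, form_one, pairing_one, ← Finset.sum_add_distrib,
      ← Finset.sum_add_distrib]
    refine Finset.sum_congr rfl fun k _ => ?_
    have e1 : (G f : K → ℝ) ∘ S.F k = c k f + G (T k f) := funext fun y => hGF f k y
    have e2 := ih (T k f) (φ ∘ S.F k)
    simp only [hTx, pairing_smul_left] at e2
    rw [e1, form_add_left, form_add_left, hcx, hh.form_sum_eq _ m]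
    have hr := (hS.r_pos k).ne'
    have e3 : S.p k = (S.r k)⁻¹ * S.ρ := by rw [← hS.r_mul_p k]; field_simp
    rw [e3]
    linear_combination (S.r k)⁻¹ * e2

end IsD4Symmetric

end FractalData

/-! ### Normal derivatives, limits of the forms, and symmetry -/

namespace FractalData

variable {K : Type*} [MetricSpace K] [MeasurableSpace K] {S : FractalData K}
  {h : Fin 4 → K → ℝ}

theorem exists_abs_le {X : Type*} [TopologicalSpace X] [CompactSpace X] {f : X → ℝ} (hf : Continuous f) :
    ∃ B, 0 ≤ B ∧ ∀ x, |f x| ≤ B :=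
  ⟨‖(⟨f, hf⟩ : C(X, ℝ))‖, norm_nonneg _, fun x => (⟨f, hf⟩ : C(X, ℝ)).norm_coe_le_norm x⟩

theorem integral_comp_homeomorph [BorelSpace K] {μ : Measure K} {g : K ≃ₜ K}
    (hg : μ.map g = μ) {f : K → ℝ} (hf : Continuous f) : ∫ x, f (g x) ∂μ = ∫ x, f x ∂μ := by
  conv_rhs => rw [← hg]
  rw [integral_map g.continuous.measurable.aemeasurable hf.aestronglyMeasurable]

theorem IsHarmonicBasis.exists_abs_le [CompactSpace K] (hh : S.IsHarmonicBasis h) :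
    ∃ B, 0 ≤ B ∧ ∀ i x, |h i x| ≤ B := by
  choose b hb0 hb using fun i => FractalData.exists_abs_le (hh.continuous i)
  exact ⟨∑ i, b i, Finset.sum_nonneg fun i _ => hb0 i, fun i x => (hb i x).trans
    (Finset.single_le_sum (fun i _ => hb0 i) (Finset.mem_univ i))⟩

namespace IsWeakSolution

theorem of_harmonic (hh : S.IsHarmonicBasis h) (a : Fin 4 → ℝ) :
    S.IsWeakSolution h (∑ i, a i • h i) 0 := fun m φ => by
  rw [hh.form_sum_eq]
  simp [pairing]

theorem basis (hh : S.IsHarmonicBasis h) (i : Fin 4) : S.IsWeakSolution h (h i) 0 := fun m φ => by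
  rw [hh.form_eq]
  simp [pairing]

theorem add [CompactSpace K] [BorelSpace K] (hS : S.IsD4Symmetric) (hh : S.IsHarmonicBasis h)
    {u f v g : K → ℝ} (hu : S.IsWeakSolution h u f) (hv : S.IsWeakSolution h v g)
    (hf : Continuous f) (hg : Continuous g) : S.IsWeakSolution h (u + v) (f + g) := fun m φ => by
  rw [form_add_left, form_add_left, hS.pairing_add_left hh m hf hg,
    hS.pairing_add_left hh 0 hf hg]
  linarith [hu m φ, hv m φ]

end IsWeakSolution

namespace IsD4Symmetric

theorem abs_integral_le (hS : S.IsD4Symmetric) {f : K → ℝ} {C : ℝ} (hf : ∀ x, |f x| ≤ C) :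
    |∫ x, f x ∂S.μ| ≤ C := by
  have := hS.isProbabilityMeasure
  simpa using norm_integral_le_of_norm_le_const (μ := S.μ) (f := f) (C := C)
    (Eventually.of_forall hf)

open Classical in
theorem sum_corner_q (hS : S.IsD4Symmetric) (m : ℕ) (l : Fin 4) (g : S.Word m → Fin 4 → ℝ) :
    (∑ w, ∑ i, if S.cellMap m w (S.q i) = S.q l then g w i else 0) =
      g (fun _ => S.idx l) l := by
  rw [Finset.sum_eq_single (fun _ => S.idx l), Finset.sum_eq_single l]
  · rw [if_pos (hS.cellMap_eq_q_iff.2 ⟨rfl, rfl⟩)]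
  · intro i _ hi
    exact if_neg fun e => hi (hS.cellMap_eq_q_iff.1 e).2
  · simp
  · intro w _ hw
    exact Finset.sum_eq_zero fun i _ => if_neg fun e => hw (hS.cellMap_eq_q_iff.1 e).1
  · simp

theorem rWord_const (hS : S.IsD4Symmetric) (m : ℕ) (l : Fin 4) :
    S.rWord (fun _ => S.idx l : S.Word m) = S.r₀ ^ m := by
  simp [rWord, hS.r_boundary]

variable [CompactSpace K]

/-- Normal derivatives of weak solutions exist, by the Gauss–Green formula. -/
theorem hasNormalDeriv (hS : S.IsD4Symmetric) (hh : S.IsHarmonicBasis h) {u f : K → ℝ}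
    (hu : S.IsWeakSolution h u f) (hf : Continuous f) (l : Fin 4) :
    S.HasNormalDeriv u l (4 * u (S.q l) - ∑ j, u (S.q j) + ∫ x, h l x * f x ∂S.μ) := by
  classical
  set D := 4 * u (S.q l) - ∑ j, u (S.q j) + ∫ x, h l x * f x ∂S.μ
  set W : ∀ k, S.Word k := fun k _ => S.idx l
  -- Only the cell of the word `l ⋯ l` contains `q_l`, so testing with the indicator of `q_l`
  -- isolates the difference quotient in the normal derivative. Comparison with level 0 evaluates it
  -- up to an integral over that cell, which decays like `μ_l^k`.
  have key : ∀ k : ℕ, S.form k u (fun y => if y = S.q l then 1 else 0) +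
      S.pairing h k f (fun y => if y = S.q l then 1 else 0) =
      (S.r₀ ^ k)⁻¹ * (4 * u (S.q l) - ∑ j, u ((S.F (S.idx l))^[k] (S.q j))) +
      S.pWord (W k) * ∫ x, h l x * f (S.cellMap k (W k) x) ∂S.μ := by
    intro k
    congr 1
    · rw [form_indicator, graphLaplacian_eq, hS.sum_corner_q, hS.rWord_const,
        hS.cellMap_eq_q_iff.2 ⟨rfl, rfl⟩, cellMap_const]
      ring
    · rw [pairing, ← hS.sum_corner_q k l fun w i =>
        S.pWord w * ∫ x, h i x * f (S.cellMap k w x) ∂S.μ]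
      refine Finset.sum_congr rfl fun w _ => ?_
      rw [Finset.mul_sum]
      exact Finset.sum_congr rfl fun i _ => by split_ifs <;> ring
  have hD : ∀ k : ℕ, (S.r₀ ^ k)⁻¹ * (3 * u (S.q l) -
      ∑ j ∈ Finset.univ.erase l, u ((S.F (S.idx l))^[k] (S.q j))) =
      D - S.pWord (W k) * ∫ x, h l x * f (S.cellMap k (W k) x) ∂S.μ := by
    intro k
    have h1 := hu k fun y => if y = S.q l then 1 else 0
    rw [key, key] at h1
    have h2 := Finset.add_sum_erase Finset.univ
      (fun j => u ((S.F (S.idx l))^[k] (S.q j))) (Finset.mem_univ l)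
    have h3 : (S.F (S.idx l))^[k] (S.q l) = S.q l := by
      rw [← cellMap_const]
      exact hS.cellMap_eq_q_iff.2 ⟨rfl, rfl⟩
    rw [h3] at h2
    have h4 : 4 * u (S.q l) - ∑ j, u ((S.F (S.idx l))^[k] (S.q j)) = 3 * u (S.q l) -
      ∑ j ∈ Finset.univ.erase l, u ((S.F (S.idx l))^[k] (S.q j)) := by linarith
    rw [h4] at h1
    simp only [pow_zero, inv_one, one_mul, Function.iterate_zero, id, pWord_zero,
      cellMap_zero] at h1
    linarith
  obtain ⟨A, hA0, hA⟩ := hh.exists_abs_le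
  obtain ⟨B, hB0, hB⟩ := FractalData.exists_abs_le hf
  unfold HasNormalDeriv
  simp only [hD]
  have hlim : Tendsto (fun k => S.pWord (W k) * ∫ x, h l x * f (S.cellMap k (W k) x) ∂S.μ)
      atTop (𝓝 0) := by
    refine squeeze_zero_norm (a := fun k => S.p (S.idx l) ^ k * (A * B)) (fun k => ?_) ?_
    · have hp : S.pWord (W k) = S.p (S.idx l) ^ k := by simp [pWord, W]
      rw [norm_mul, hp, norm_pow, Real.norm_of_nonneg (hS.p_pos _).le]
      refine mul_le_mul_of_nonneg_left ?_ (pow_nonneg (hS.p_pos _).le k)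
      refine hS.abs_integral_le fun x => ?_
      rw [abs_mul]
      exact mul_le_mul (hA l x) (hB _) (abs_nonneg _) hA0
    · simpa using (tendsto_pow_atTop_nhds_zero_of_lt_one (hS.p_pos (S.idx l)).le
        (hS.p_lt_one _)).mul_const (A * B)
  simpa using hlim.const_sub D

variable [ConnectedSpace K] [BorelSpace K]

/-- Since the `h i` sum to 1, the spline differs from `φ` on a cell by at most a constant times the
oscillation of `φ` there. -/
theorem tendsto_pairing (hS : S.IsD4Symmetric) (hh : S.IsHarmonicBasis h) {f φ : K → ℝ}
    (hf : Continuous f) (hφ : Continuous φ) :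
    Tendsto (fun m => S.pairing h m f φ) atTop (𝓝 (∫ x, f x * φ x ∂S.μ)) := by
  obtain ⟨A, hA0, hA⟩ := hh.exists_abs_le
  obtain ⟨B, hB0, hB⟩ := FractalData.exists_abs_le hf
  rw [Metric.tendsto_atTop]
  intro ε hε
  have hC : 0 < 4 * A * B + 1 := by positivity
  obtain ⟨M, hM⟩ := hS.eventually_osc_lt hφ (div_pos hε hC)
  refine ⟨M, fun m hm => ?_⟩
  set η := ε / (4 * A * B + 1)
  have hη : η * (4 * A * B + 1) = ε := div_mul_cancel₀ _ hC.ne'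
  have hη0 : 0 < η := div_pos hε hC
  have hcell : ∀ w : S.Word m, |(∑ i, φ (S.cellMap m w (S.q i)) *
      ∫ x, h i x * f (S.cellMap m w x) ∂S.μ) -
      ∫ x, f (S.cellMap m w x) * φ (S.cellMap m w x) ∂S.μ| ≤ η * (4 * A * B) := by
    intro w
    have hfw := hf.comp (hS.continuous_cellMap m w)
    have hφw := hφ.comp (hS.continuous_cellMap m w)
    have e1 := hS.sum_mul_integral hh (fun i => φ (S.cellMap m w (S.q i))) hfw
    simp only [Function.comp_apply] at e1
    have hc := hh.continuous_sum fun i => φ (S.cellMap m w (S.q i))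
    have hc' : Continuous fun x => ∑ i, φ (S.cellMap m w (S.q i)) * h i x := by
      convert hc using 1
      funext x
      simp
    rw [e1, ← integral_sub
      (f := fun x => (∑ i, φ (S.cellMap m w (S.q i)) * h i x) * f (S.cellMap m w x))
      (g := fun x => f (S.cellMap m w x) * φ (S.cellMap m w x)) (hS.integrable (hc'.mul hfw)) (hS.integrable (hfw.mul hφw))]
    refine hS.abs_integral_le fun x => ?_
    have e2 : (∑ i, φ (S.cellMap m w (S.q i)) * h i x) * f (S.cellMap m w x) -
        f (S.cellMap m w x) * φ (S.cellMap m w x) =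
        (∑ i, (φ (S.cellMap m w (S.q i)) - φ (S.cellMap m w x)) * h i x) *
          f (S.cellMap m w x) := by
      simp only [sub_mul, Finset.sum_sub_distrib]
      rw [← Finset.mul_sum, hS.sum_harmonicBasis hh]
      ring
    rw [e2, abs_mul]
    have e3 : |∑ i, (φ (S.cellMap m w (S.q i)) - φ (S.cellMap m w x)) * h i x| ≤
        ∑ _i : Fin 4, η * A := by
      refine (Finset.abs_sum_le_sum_abs _ _).trans (Finset.sum_le_sum fun i _ => ?_)
      rw [abs_mul]
      exact mul_le_mul (hM m hm w _ _).le (hA i x) (abs_nonneg _) hη0.le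
    have e4 := mul_le_mul e3 (hB (S.cellMap m w x)) (abs_nonneg _) ((abs_nonneg _).trans e3)
    refine e4.trans (le_of_eq ?_)
    simp
    ring
  rw [Real.dist_eq, pairing, hS.integral_eq_sum_word m (f := fun x => f x * φ x) (hf.mul hφ),
    ← Finset.sum_sub_distrib]
  simp only [← mul_sub]
  refine (Finset.abs_sum_le_sum_abs _ _).trans_lt ?_
  refine lt_of_le_of_lt (b := ∑ w : S.Word m, S.pWord w * (η * (4 * A * B)))
    (Finset.sum_le_sum fun w _ => ?_) ?_
  · rw [abs_mul, abs_of_pos (hS.pWord_pos w)]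
    exact mul_le_mul_of_nonneg_left (hcell w) (hS.pWord_pos w).le
  · rw [← Finset.sum_mul, hS.sum_pWord, one_mul]
    linarith

theorem tendsto_form (hS : S.IsD4Symmetric) (hh : S.IsHarmonicBasis h) {u f φ : K → ℝ}
    (hu : S.IsWeakSolution h u f) (hf : Continuous f) (hφ : Continuous φ) :
    Tendsto (fun m => S.form m u φ) atTop
      (𝓝 (S.form 0 u φ + S.pairing h 0 f φ - ∫ x, f x * φ x ∂S.μ)) := by
  have e : (fun m => S.form m u φ) =
      fun m => S.form 0 u φ + S.pairing h 0 f φ - S.pairing h m f φ :=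
    funext fun m => by rw [← hu m φ]; ring
  rw [e]
  exact (hS.tendsto_pairing hh hf hφ).const_sub _

theorem tendsto_form_of_vanishing (hS : S.IsD4Symmetric) (hh : S.IsHarmonicBasis h)
    {u f φ : K → ℝ} (hu : S.IsWeakSolution h u f) (hf : Continuous f) (hφ : Continuous φ)
    (h0 : ∀ i, φ (S.q i) = 0) :
    Tendsto (fun m => S.form m u φ) atTop (𝓝 (- ∫ x, f x * φ x ∂S.μ)) := by
  have := hS.tendsto_form hh hu hf hφ
  simpa [form_zero, pairing_zero, h0] using this

-- The symmetries are only known to preserve the supremum in `[0, ∞]`; monotonicity in the level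
-- turns this into equality of real limits.
omit [CompactSpace K] [ConnectedSpace K] [BorelSpace K] in
theorem tendsto_energy_of_totalEnergy_eq (hS : S.IsD4Symmetric) {u v : K → ℝ} {e : ℝ}
    (h : S.totalEnergy v = S.totalEnergy u) (hu : Tendsto (fun m => S.energy m u) atTop (𝓝 e)) :
    Tendsto (fun m => S.energy m v) atTop (𝓝 e) := by
  have key : ∀ {w : K → ℝ} {t : ℝ}, Tendsto (fun m => S.energy m w) atTop (𝓝 t) →
      S.totalEnergy w = ENNReal.ofReal t := fun {w t} hw =>
    iSup_eq_of_tendsto (fun _ _ hmn => ENNReal.ofReal_le_ofReal (hS.energy_mono w hmn))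
      (ENNReal.tendsto_ofReal hw)
  have he0 : 0 ≤ e := ge_of_tendsto' hu fun m => hS.energy_nonneg m u
  have hbd : ∀ m, S.energy m v ≤ e := fun m => by
    have h1 : ENNReal.ofReal (S.energy m v) ≤ S.totalEnergy v :=
      le_iSup (fun m => ENNReal.ofReal (S.energy m v)) m
    rw [h, key hu] at h1
    exact (ENNReal.ofReal_le_ofReal_iff he0).1 h1
  obtain ⟨t, ht⟩ : ∃ t, Tendsto (fun m => S.energy m v) atTop (𝓝 t) :=
    ⟨_, tendsto_atTop_ciSup (hS.energy_mono v) ⟨e, by rintro _ ⟨m, rfl⟩; exact hbd m⟩⟩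
  have ht0 : 0 ≤ t := ge_of_tendsto' ht fun m => hS.energy_nonneg m v
  have h2 := key ht
  rw [h, key hu, ENNReal.ofReal_eq_ofReal_iff he0 ht0] at h2
  rwa [h2]

/-- Weak solutions are compatible with the symmetries of `K`. -/
theorem weakSolution_comp (hS : S.IsD4Symmetric) (hh : S.IsHarmonicBasis h)
    {σ : Equiv.Perm (Fin 4)} {g : K ≃ₜ K} (hg : ∀ l, g (S.q l) = S.q (σ l))
    (hgE : ∀ u : K → ℝ, Continuous u → S.totalEnergy (u ∘ g) = S.totalEnergy u)
    (hgμ : S.μ.map g = S.μ) {u₁ u₂ f₁ : K → ℝ} (hu₁ : Continuous u₁) (hu₂ : Continuous u₂)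
    (hf₁ : Continuous f₁) (h₁ : S.IsWeakSolution h u₁ f₁)
    (h₂ : S.IsWeakSolution h u₂ (f₁ ∘ g)) (hq : ∀ i, u₂ (S.q i) = u₁ (S.q (σ i))) :
    u₂ = u₁ ∘ g := by
  have hf₂ : Continuous (f₁ ∘ g) := hf₁.comp g.continuous
  -- The map `g` need not preserve the vertex sets, so forms cannot be compared level by level.
  -- Instead the total energy is expanded twice, for `u₁ ∘ g = u₂ + v` and for `u₂ ∘ g⁻¹ = u₁ - v'`;
  -- the mixed terms are known from the weak equations.
  set v : K → ℝ := u₁ ∘ g - u₂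
  have hv : Continuous v := (hu₁.comp g.continuous).sub hu₂
  have hvq : ∀ i, v (S.q i) = 0 := fun i => by simp [v, hq, hg]
  set v' : K → ℝ := v ∘ g.symm
  have hv' : Continuous v' := hv.comp g.symm.continuous
  have hvg : v' ∘ g = v := by funext x; simp [v']
  have hvq' : ∀ i, v' (S.q i) = 0 := fun i => by
    have : g.symm (S.q i) = S.q (σ.symm i) := by
      rw [Homeomorph.symm_apply_eq, hg, Equiv.apply_symm_apply]
    simp only [v', Function.comp_apply, this, hvq]
  have E₁ := hS.tendsto_form hh h₁ hf₁ hu₁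
  have E₂ := hS.tendsto_form hh h₂ hf₂ hu₂
  simp only [← energy_eq_form] at E₁ E₂
  set e₁ := S.energy 0 u₁ + S.pairing h 0 f₁ u₁ - ∫ x, f₁ x * u₁ x ∂S.μ
  set e₂ := S.energy 0 u₂ + S.pairing h 0 (f₁ ∘ g) u₂ - ∫ x, (f₁ ∘ g) x * u₂ x ∂S.μ
  have C₂ := hS.tendsto_form_of_vanishing hh h₂ hf₂ hv hvq
  have C₁ := hS.tendsto_form_of_vanishing hh h₁ hf₁ hv' hvq'
  have hI : ∫ x, f₁ x * v' x ∂S.μ = ∫ x, (f₁ ∘ g) x * v x ∂S.μ := by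
    rw [← hvg]
    exact (integral_comp_homeomorph hgμ (hf₁.mul hv')).symm
  rw [hI] at C₁
  set I := ∫ x, (f₁ ∘ g) x * v x ∂S.μ
  have W₁ := hS.tendsto_energy_of_totalEnergy_eq (hgE u₁ hu₁) E₁
  have W₂ : Tendsto (fun m => S.energy m (u₂ ∘ g.symm)) atTop (𝓝 e₂) := by
    refine hS.tendsto_energy_of_totalEnergy_eq ?_ E₂
    rw [← hgE _ (hu₂.comp g.symm.continuous)]
    congr 1
    funext x
    simp
  have EV : Tendsto (fun m => S.energy m v) atTop (𝓝 (e₁ - e₂ - 2 * -I)) := by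
    refine ((W₁.sub E₂).sub (C₂.const_mul 2)).congr fun m => ?_
    have h1 := S.energy_add m u₂ v
    have h2 : u₂ + v = u₁ ∘ g := by simp [v]
    rw [h2] at h1
    linarith
  have EV' : Tendsto (fun m => S.energy m v') atTop (𝓝 (e₂ - e₁ + 2 * -I)) := by
    refine ((W₂.sub E₁).add (C₁.const_mul 2)).congr fun m => ?_
    have h1 := S.energy_add m (u₂ ∘ g.symm) v'
    have h2 : u₂ ∘ g.symm + v' = u₁ := by funext x; simp [v', v]
    have h3 : u₂ ∘ g.symm = u₁ - v' := by rw [← h2, add_sub_cancel_right]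
    have h4 := S.form_sub_left m u₁ v' v'
    rw [h2, h3, h4, ← energy_eq_form, ← h3] at h1
    linarith
  have EV'' := hS.tendsto_energy_of_totalEnergy_eq
    (u := v) (v := v') (by rw [← hgE v' hv', hvg]) EV
  -- The two expansions give opposite values for the energies of `v'` and `v`, while invariance
  -- makes them equal; both are therefore zero.
  have hlim := tendsto_nhds_unique EV' EV''
  have hz : e₁ - e₂ - 2 * -I = 0 := by linarith
  rw [hz] at EV
  have hv0 := hS.eq_zero_of_forall_energy_nonpos hv
    (fun m => (hS.energy_mono v).ge_of_tendsto EV m) hvq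
  exact (sub_eq_zero.1 hv0).symm

theorem harmonicBasis_comp (hS : S.IsD4Symmetric) (hh : S.IsHarmonicBasis h)
    {σ : Equiv.Perm (Fin 4)} {g : K ≃ₜ K} (hg : ∀ l, g (S.q l) = S.q (σ l))
    (hgE : ∀ u : K → ℝ, Continuous u → S.totalEnergy (u ∘ g) = S.totalEnergy u)
    (hgμ : S.μ.map g = S.μ) (i : Fin 4) : h i = h (σ i) ∘ g :=
  hS.weakSolution_comp hh hg hgE hgμ (hh.continuous _) (hh.continuous _) continuous_zero
    (IsWeakSolution.basis hh (σ i)) (IsWeakSolution.basis hh i) fun j => by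
      simp [hh.apply_q]

/-- Transpositions make the four integrals equal, and the functions sum to 1. -/
theorem integral_harmonicBasis (hS : S.IsD4Symmetric) (hh : S.IsHarmonicBasis h) (i : Fin 4) :
    ∫ x, h i x ∂S.μ = 1 / 4 := by
  have := hS.isProbabilityMeasure
  have h1 : ∀ j, ∫ x, h j x ∂S.μ = ∫ x, h i x ∂S.μ := by
    intro j
    obtain ⟨g, hg, hgE, hgμ⟩ := hS.symmetric (Equiv.swap j i)
    have h2 := hS.harmonicBasis_comp hh hg hgE hgμ j
    rw [Equiv.swap_apply_left] at h2
    rw [h2]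
    exact integral_comp_homeomorph hgμ (hh.continuous i)
  have h2 : ∑ j, ∫ x, h j x ∂S.μ = 1 := by
    rw [← integral_finsetSum _ fun j _ => hS.integrable (hh.continuous j)]
    simp [hS.sum_harmonicBasis hh]
  simp only [h1, Finset.sum_const, Finset.card_univ, Fintype.card_fin, nsmul_eq_mul] at h2
  push_cast at h2
  linarith

end IsD4Symmetric

end FractalData

/-! ### Linearity of normal derivatives and the triangular matching system -/

namespace FractalData

section Linear

variable {K : Type*} [MeasurableSpace K] {S : FractalData K}

theorem HasNormalDeriv.add [TopologicalSpace K] {u v : K → ℝ} {l : Fin 4} {d e : ℝ}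
    (hu : S.HasNormalDeriv u l d) (hv : S.HasNormalDeriv v l e) :
    S.HasNormalDeriv (u + v) l (d + e) := by
  refine (Tendsto.add hu hv).congr fun k => ?_
  simp only [Pi.add_apply, Finset.sum_add_distrib]
  ring

theorem HasNormalDeriv.smul [TopologicalSpace K] {u : K → ℝ} {l : Fin 4} {d : ℝ}
    (hu : S.HasNormalDeriv u l d) (c : ℝ) : S.HasNormalDeriv (c • u) l (c * d) := by
  refine (Tendsto.const_mul c hu).congr fun k => ?_
  simp only [Pi.smul_apply, smul_eq_mul, ← Finset.mul_sum]
  ring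

theorem HasNormalDeriv.zero [TopologicalSpace K] (l : Fin 4) :
    S.HasNormalDeriv (0 : K → ℝ) l 0 := by
  simp [HasNormalDeriv]

theorem HasNormalDeriv.sum [TopologicalSpace K] {ι : Type*} (s : Finset ι) {u : ι → K → ℝ}
    {l : Fin 4} {d : ι → ℝ} (hu : ∀ i ∈ s, S.HasNormalDeriv (u i) l (d i)) :
    S.HasNormalDeriv (∑ i ∈ s, u i) l (∑ i ∈ s, d i) := by
  classical
  induction s using Finset.induction_on with
  | empty => exact .zero l
  | insert a s ha ih =>
    rw [Finset.sum_insert ha, Finset.sum_insert ha]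
    exact (hu a (Finset.mem_insert_self a s)).add
      (ih fun i hi => hu i (Finset.mem_insert_of_mem hi))

/-- Solution of the triangular system expressing the matching conditions. -/
theorem solve_matching {a b c α β : ℕ → ℝ} {n : ℕ} (ha : a 0 = 3) (hb : b 0 = -1)
    (hc0 : c 0 = 1)
    (hc : ∀ j ≥ 1, c j = 1 / 3 * a j + ∑ s ∈ Finset.range j, b (j - s) * c s)
    (h : ∀ N i, i + N = n →
      ∑ t ∈ Finset.range (N + 1), (a t * α (i + t) + b t * β (i + t)) = 0) (N : ℕ) :
    -- Back substitution, descending in `i`: the equation for `i` starts with `3 α_i - β_i`, and all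
    -- other `β` in it are known.
    ∀ i, i + N = n → β i = 3 * ∑ t ∈ Finset.range (N + 1), c t * α (i + t) := by
  induction N using Nat.strong_induction_on with
  | _ N ih =>
    intro i hi
    have h1 := h N i hi
    rw [Finset.sum_range_succ', ha, hb, Finset.sum_add_distrib] at h1
    rw [Finset.sum_range_succ', hc0]
    -- After substitution, collecting the coefficient of `α (i + (d + 1))` along the antidiagonal `t
    -- + s = d` produces the convolution in the recursion for `c`.
    have h2 : ∑ t ∈ Finset.range N, b (t + 1) * β (i + (t + 1)) =
        3 * ∑ d ∈ Finset.range N, (∑ s ∈ Finset.range (d + 1), b (d + 1 - s) * c s) *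
          α (i + (d + 1)) := by
      have e1 : ∀ t ∈ Finset.range N, b (t + 1) * β (i + (t + 1)) =
          ∑ s ∈ Finset.range (N - t), 3 * (b (t + 1) * c s * α (i + (t + s + 1))) := by
        intro t ht
        have ht' := Finset.mem_range.1 ht
        rw [ih (N - (t + 1)) (by omega) (i + (t + 1)) (by omega),
          show N - (t + 1) + 1 = N - t by omega, Finset.mul_sum, Finset.mul_sum]
        refine Finset.sum_congr rfl fun s _ => ?_
        rw [show i + (t + 1) + s = i + (t + s + 1) by ring]
        ring
      rw [Finset.sum_congr rfl e1, ← Finset.sum_range_diag_flip N fun t s =>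
        3 * (b (t + 1) * c s * α (i + (t + s + 1))), Finset.mul_sum]
      refine Finset.sum_congr rfl fun d _ => ?_
      rw [Finset.sum_mul, Finset.mul_sum, ← Finset.sum_range_reflect]
      refine Finset.sum_congr rfl fun s hs => ?_
      have hs' := Finset.mem_range.1 hs
      rw [show d + 1 - 1 - s + 1 = d + 1 - s by omega, show d - (d + 1 - 1 - s) = s by omega,
        show d + 1 - 1 - s + s + 1 = d + 1 by omega]
    have h3 : ∑ t ∈ Finset.range N, c (t + 1) * α (i + (t + 1)) =
        1 / 3 * ∑ t ∈ Finset.range N, a (t + 1) * α (i + (t + 1)) +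
        ∑ d ∈ Finset.range N, (∑ s ∈ Finset.range (d + 1), b (d + 1 - s) * c s) *
          α (i + (d + 1)) := by
      rw [Finset.mul_sum, ← Finset.sum_add_distrib]
      refine Finset.sum_congr rfl fun t _ => ?_
      rw [hc (t + 1) (by omega)]
      ring
    rw [h2] at h1
    rw [h3]
    simp only [add_zero] at h1 ⊢
    linarith

open Classical in
theorem sum_corner_pos {m : ℕ} {x : K} (hx : x ∈ S.V m) {g : S.Word m → ℝ}
    (hg : ∀ w, 0 < g w) :
    0 < ∑ w, ∑ i, if S.cellMap m w (S.q i) = x then g w else 0 := by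
  obtain ⟨w, i, hwi⟩ := hx
  have h0 : ∀ w i, 0 ≤ if S.cellMap m w (S.q i) = x then g w else 0 := fun w i => by
    split_ifs
    · exact (hg w).le
    · exact le_rfl
  refine Finset.sum_pos' (fun w _ => Finset.sum_nonneg fun i _ => h0 w i)
    ⟨w, Finset.mem_univ w, Finset.sum_pos' (fun i _ => h0 w i) ⟨i, Finset.mem_univ i, ?_⟩⟩
  rw [if_pos hwi]
  exact hg w

end Linear

/-! ### Tent functions; weak solutions against the pointwise Laplacian -/

variable {K : Type*} [MetricSpace K] [MeasurableSpace K] {S : FractalData K}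
  {h : Fin 4 → K → ℝ}

namespace IsD4Symmetric

variable [CompactSpace K] [ConnectedSpace K]

/-- Level by level, the combination `v` of the basis competes with `u`; as `v` is orthogonal to `u -
v`, minimality of `u` forces the energy of `u - v` to vanish. -/
theorem eq_sum_of_isHarmonic (hS : S.IsD4Symmetric) (hh : S.IsHarmonicBasis h) {u : K → ℝ}
    (hu : S.IsHarmonic u) : u = ∑ i, u (S.q i) • h i := by
  set v : K → ℝ := ∑ i, u (S.q i) • h i
  have hq : ∀ i, v (S.q i) = u (S.q i) := hh.sum_apply_q fun i => u (S.q i)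
  have h0 : ∀ i, (u - v) (S.q i) = 0 := fun i => sub_eq_zero.2 (hq i).symm
  refine hS.ext_of_vertices hu.1 (hh.continuous_sum _) fun m => ?_
  induction m with
  | zero =>
    intro y hy
    obtain ⟨i, rfl⟩ := S.mem_V_zero.1 hy
    exact (hq i).symm
  | succ m ih =>
    intro y hy
    have h1 := hu.2 m v fun y hy => (ih y hy).symm
    have h2 := S.energy_add (m + 1) v (u - v)
    have h3 : S.form (m + 1) v (u - v) = 0 := by
      rw [hh.form_sum_eq, form_zero]
      simp only [h0]
      simp
    rw [add_sub_cancel, h3] at h2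
    exact sub_eq_zero.1 (hS.eq_zero_of_energy_nonpos (by linarith) h0 hy)

omit [CompactSpace K] [ConnectedSpace K] in
theorem isHarmonic_sum (hS : S.IsD4Symmetric) (hh : S.IsHarmonicBasis h) (a : Fin 4 → ℝ) :
    S.IsHarmonic (∑ i, a i • h i) := by
  refine ⟨hh.continuous_sum a, fun m v hv => ?_⟩
  calc S.energy (m + 1) (∑ i, a i • h i) = S.energy m (∑ i, a i • h i) := by
        rw [energy_eq_form, energy_eq_form, hh.form_sum_eq, hh.form_sum_eq a m]
    _ = S.energy m v := by
        rw [energy_eq_form, energy_eq_form]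
        exact S.form_congr (fun y hy => (hv y hy).symm) fun y hy => (hv y hy).symm
    _ ≤ S.energy (m + 1) v := hS.energy_mono v m.le_succ

omit [ConnectedSpace K] in
/-- Piecewise harmonic splines. -/
theorem exists_spline (hS : S.IsD4Symmetric) (hh : S.IsHarmonicBasis h) (m : ℕ) (φ : K → ℝ) :
    ∃ ψ : C(K, ℝ), ∀ w : S.Word m,
      (ψ : K → ℝ) ∘ S.cellMap m w = ∑ i, φ (S.cellMap m w (S.q i)) • h i := by
  induction m generalizing φ with
  | zero => exact ⟨⟨∑ i, φ (S.q i) • h i, hh.continuous_sum _⟩, fun _ => rfl⟩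
  | succ m ih =>
    choose ψ hψ using fun k => ih (φ ∘ S.F k)
    have hq : ∀ k i, ψ k (S.q i) = φ (S.F k (S.q i)) := by
      intro k i
      have e1 : S.cellMap m (fun _ => S.idx i) (S.q i) = S.q i := hS.cellMap_eq_q_iff.2 ⟨rfl, rfl⟩
      have e2 := congrFun (hψ k fun _ => S.idx i) (S.q i)
      rw [hh.sum_apply_q fun j => (φ ∘ S.F k) (S.cellMap m (fun _ => S.idx i) (S.q j))] at e2
      simpa [e1] using e2
    obtain ⟨u, hu⟩ := hS.exists_glue ψ fun k l i j e => by rw [hq, hq, e]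
    refine ⟨u, fun w => ?_⟩
    exact (funext fun y => hu _ _).trans (hψ (w 0) fun i => w i.succ)

omit [ConnectedSpace K] in
theorem exists_isTent (hS : S.IsD4Symmetric) (hh : S.IsHarmonicBasis h) {m : ℕ} {x : K}
    (hx : x ∈ S.V m) : ∃ ψ, S.IsTent m x ψ := by
  classical
  obtain ⟨ψ, hψ⟩ := hS.exists_spline hh m fun y => if y = x then 1 else 0
  have hv : ∀ y ∈ S.V m, ψ y = if y = x then 1 else 0 := by
    rintro _ ⟨w, i, rfl⟩
    have := congrFun (hψ w) (S.q i)
    rwa [hh.sum_apply_q fun i => if S.cellMap m w (S.q i) = x then (1 : ℝ) else 0] at this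
  refine ⟨ψ, ψ.continuous, fun w => ?_, by simp [hv x hx], fun y hy hyx => by simp [hv y hy, hyx]⟩
  rw [hψ]
  exact hS.isHarmonic_sum hh fun i => if S.cellMap m w (S.q i) = x then (1 : ℝ) else 0

variable [BorelSpace K]

-- On a cell the tent is the sum of the basis functions belonging to corners at `x`, each of
-- integral `1/4`.
open Classical in
theorem integral_tent (hS : S.IsD4Symmetric) (hh : S.IsHarmonicBasis h) {m : ℕ} {x : K}
    (hx : x ∈ S.V m) : ∫ y, S.tent m x y ∂S.μ =
      1 / 4 * ∑ w, ∑ i, if S.cellMap m w (S.q i) = x then S.pWord w else 0 := by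
  have hT : S.IsTent m x (S.tent m x) := by
    have hex := hS.exists_isTent hh hx
    rw [tent, dif_pos hex]
    exact hex.choose_spec
  set ψ := S.tent m x
  obtain ⟨hψc, hψh, hψ1, hψ0⟩ := hT
  have hv : ∀ (w : S.Word m) i, ψ (S.cellMap m w (S.q i)) =
      if S.cellMap m w (S.q i) = x then 1 else 0 := by
    intro w i
    split_ifs with hwi
    · rw [hwi, hψ1]
    · exact hψ0 _ ⟨w, i, rfl⟩ hwi
  rw [hS.integral_eq_sum_word m hψc, Finset.mul_sum]
  refine Finset.sum_congr rfl fun w _ => ?_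
  have e1 : ∀ y, ψ (S.cellMap m w y) =
      ∑ i, (if S.cellMap m w (S.q i) = x then 1 else 0) * h i y := by
    intro y
    have := congrFun (hS.eq_sum_of_isHarmonic hh (hψh w)) y
    simpa only [hv, Function.comp_apply, Finset.sum_apply, Pi.smul_apply, smul_eq_mul] using this
  simp only [e1]
  rw [integral_finsetSum _ fun i _ => (hS.integrable (hh.continuous i)).const_mul _]
  simp only [integral_const_mul, hS.integral_harmonicBasis hh, Finset.mul_sum]
  exact Finset.sum_congr rfl fun i _ => by split_ifs <;> ring

/-- Weak solutions have a Laplacian in the sense of uniform convergence. -/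
theorem hasLaplacian (hS : S.IsD4Symmetric) (hh : S.IsHarmonicBasis h) {u f : K → ℝ}
    (hu : Continuous u) (hf : Continuous f) (hw : S.IsWeakSolution h u f) :
    S.HasLaplacian u f := by
  classical
  refine ⟨hu, hf, fun ε hε => ?_⟩
  obtain ⟨A, hA0, hA⟩ := hh.exists_abs_le
  have hC : 0 < 4 * A + 1 := by positivity
  obtain ⟨M, hM⟩ := hS.eventually_osc_lt hf (div_pos hε hC)
  set η := ε / (4 * A + 1)
  have hη : η * (4 * A + 1) = ε := div_mul_cancel₀ _ hC.ne'
  have hη0 : 0 < η := div_pos hε hC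
  refine ⟨M, fun m hm x hx hx0 => ?_⟩
  have hW := sum_corner_pos hx (g := fun w => S.pWord w) hS.pWord_pos
  rw [renormLaplacian, hS.integral_tent hh hx, hw.graphLaplacian_eq hx0]
  set W := ∑ w, ∑ i, if S.cellMap m w (S.q i) = x then S.pWord w else 0
  -- Because each `h i` has integral `1/4`, subtracting `f x` amounts to replacing `f` by `f - f x`
  -- under the integrals, which is small on the cells at `x`.
  have e1 : (∑ w, ∑ i, if S.cellMap m w (S.q i) = x then
      S.pWord w * ∫ y, h i y * f (S.cellMap m w y) ∂S.μ else 0) - 1 / 4 * W * f x =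
      ∑ w, ∑ i, if S.cellMap m w (S.q i) = x then
        S.pWord w * ∫ y, h i y * (f (S.cellMap m w y) - f x) ∂S.μ else 0 := by
    simp only [W, Finset.mul_sum, Finset.sum_mul, ← Finset.sum_sub_distrib]
    refine Finset.sum_congr rfl fun w _ => Finset.sum_congr rfl fun i _ => ?_
    split_ifs with hwi
    · have e2 : ∫ y, h i y * (f (S.cellMap m w y) - f x) ∂S.μ =
          (∫ y, h i y * f (S.cellMap m w y) ∂S.μ) - 1 / 4 * f x := by
        simp only [mul_sub]
        rw [integral_sub (f := fun y => h i y * f (S.cellMap m w y)) (g := fun y => h i y * f x)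
          (hS.integrable ((hh.continuous i).mul (hf.comp (hS.continuous_cellMap m w))))
          ((hS.integrable (hh.continuous i)).mul_const _), integral_mul_const,
          hS.integral_harmonicBasis hh]
      rw [e2]
      ring
    · simp
  have e3 : |∑ w, ∑ i, if S.cellMap m w (S.q i) = x then
      S.pWord w * ∫ y, h i y * (f (S.cellMap m w y) - f x) ∂S.μ else 0| ≤ W * (A * η) := by
    simp only [W, Finset.sum_mul]
    refine (Finset.abs_sum_le_sum_abs _ _).trans (Finset.sum_le_sum fun w _ =>
      (Finset.abs_sum_le_sum_abs _ _).trans (Finset.sum_le_sum fun i _ => ?_))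
    split_ifs with hwi
    · rw [abs_mul, abs_of_pos (hS.pWord_pos w)]
      refine mul_le_mul_of_nonneg_left (hS.abs_integral_le fun y => ?_) (hS.pWord_pos w).le
      rw [abs_mul]
      refine mul_le_mul (hA i y) ?_ (abs_nonneg _) hA0
      rw [← hwi]
      exact (hM m hm w _ _).le
    · simp
  rw [← e1] at e3
  set Q := ∑ w, ∑ i, if S.cellMap m w (S.q i) = x then
      S.pWord w * ∫ y, h i y * f (S.cellMap m w y) ∂S.μ else 0
  have e4 : (1 / 4 * W)⁻¹ * Q - f x = (1 / 4 * W)⁻¹ * (Q - 1 / 4 * W * f x) := by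
    field_simp
  rw [e4, abs_mul, abs_of_pos (inv_pos.2 (by positivity))]
  calc (1 / 4 * W)⁻¹ * |Q - 1 / 4 * W * f x| ≤ (1 / 4 * W)⁻¹ * (W * (A * η)) :=
        mul_le_mul_of_nonneg_left e3 (inv_nonneg.2 (by positivity))
    _ = 4 * A * η := by field_simp
    _ < ε := by linarith

/-- A function is determined by its Laplacian and its boundary values. -/
theorem eq_of_hasLaplacian (hS : S.IsD4Symmetric) {u v f : K → ℝ} (hu : S.HasLaplacian u f)
    (hv : S.HasLaplacian v f) (hq : ∀ i, u (S.q i) = v (S.q i)) : u = v := by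
  classical
  obtain ⟨h, hh⟩ := hS.exists_harmonicBasis
  set d : K → ℝ := u - v
  have hd : Continuous d := hu.1.sub hv.1
  have h0 : ∀ i, d (S.q i) = 0 := fun i => sub_eq_zero.2 (hq i)
  obtain ⟨B, hB0, hB⟩ := FractalData.exists_abs_le hd
  refine sub_eq_zero.1 (hS.eq_zero_of_forall_energy_nonpos hd (fun n => ?_) h0)
  refine le_of_forall_pos_le_add fun ε hε => ?_
  have hC : 0 < 2 * B + 1 := by positivity
  set η := ε / (2 * B + 1)
  have hη : η * (2 * B + 1) = ε := div_mul_cancel₀ _ hC.ne'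
  have hη0 : 0 < η := div_pos hε hC
  obtain ⟨M₁, hM₁⟩ := hu.2.2 η hη0
  obtain ⟨M₂, hM₂⟩ := hv.2.2 η hη0
  set m := max n (max M₁ M₂)
  have hm₁ : M₁ ≤ m := (le_max_left _ _).trans (le_max_right _ _)
  have hm₂ : M₂ ≤ m := (le_max_right _ _).trans (le_max_right _ _)
  refine (hS.energy_mono d (le_max_left n (max M₁ M₂))).trans ?_
  change S.energy m d ≤ 0 + ε
  -- Summation by parts writes the energy of `d` as the sum of these terms. Both renormalized
  -- Laplacians are within `η` of `f`, and the weights on the right sum to 4, one unit for each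
  -- corner index, so the energy is at most `2 B η`.
  have hterm : ∀ x ∈ (S.V_finite m).toFinset, -(d x * S.graphLaplacian m d x) ≤
      B * (η / 2) * ∑ w, ∑ i, if S.cellMap m w (S.q i) = x then S.pWord w else 0 := by
    intro x hx
    have hxm := (S.V_finite m).mem_toFinset.1 hx
    have hW := sum_corner_pos hxm (g := fun w => S.pWord w) hS.pWord_pos
    have hI := hS.integral_tent hh hxm
    set W := ∑ w, ∑ i, if S.cellMap m w (S.q i) = x then S.pWord w else 0
    by_cases hx0 : x ∈ S.V 0
    · obtain ⟨i, rfl⟩ := S.mem_V_zero.1 hx0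
      rw [h0, zero_mul, neg_zero]
      positivity
    · have h1 := hM₁ m hm₁ x hxm hx0
      have h2 := hM₂ m hm₂ x hxm hx0
      rw [renormLaplacian, hI] at h1 h2
      have h3 : S.graphLaplacian m d x = S.graphLaplacian m u x - S.graphLaplacian m v x := by
        have := S.form_sub_left m u v fun y => if y = x then 1 else 0
        rw [form_indicator, form_indicator, form_indicator] at this
        linarith
      have h4 : |S.graphLaplacian m d x| ≤ η / 2 * W := by
        have h5 : S.graphLaplacian m d x =
            1 / 4 * W * (((1 / 4 * W)⁻¹ * S.graphLaplacian m u x - f x) -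
              ((1 / 4 * W)⁻¹ * S.graphLaplacian m v x - f x)) := by
          rw [h3]
          field_simp
          ring
        have h6 := (abs_sub ((1 / 4 * W)⁻¹ * S.graphLaplacian m u x - f x)
          ((1 / 4 * W)⁻¹ * S.graphLaplacian m v x - f x)).trans (add_le_add h1.le h2.le)
        rw [h5, abs_mul, abs_of_pos (show 0 < 1 / 4 * W by positivity)]
        nlinarith
      refine (neg_le_abs _).trans ?_
      rw [abs_mul, mul_assoc]
      exact mul_le_mul (hB x) h4 (abs_nonneg _) hB0
  have hsum := S.sum_vertices m (fun _ => 1) fun w _ => S.pWord w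
  simp only [one_mul, Finset.sum_const, Finset.card_univ, Fintype.card_fin, nsmul_eq_mul,
    ← Finset.mul_sum, hS.sum_pWord] at hsum
  rw [energy_eq_form, form_eq_sum_vertices, ← Finset.sum_neg_distrib]
  refine (Finset.sum_le_sum hterm).trans ?_
  rw [← Finset.mul_sum, hsum]
  push_cast
  linarith

/-- Descend from the top, where both chains vanish, solving one Dirichlet problem per step. -/
theorem chain_unique (hS : S.IsD4Symmetric) {n : ℕ} {D D' : ℕ → K → ℝ}
    (hD : S.IsMultiharmonicChain n D) (hD' : S.IsMultiharmonicChain n D')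
    (hq : ∀ i ≤ n, ∀ l, D i (S.q l) = D' i (S.q l)) {i : ℕ} (hi : i ≤ n + 1) : D i = D' i := by
  induction hi using Nat.decreasingInduction with
  | self => rw [hD.2, hD'.2]
  | of_succ k hk ih =>
    have hk' := Nat.lt_succ_iff.1 hk
    exact hS.eq_of_hasLaplacian (hD.1 k hk') (ih ▸ hD'.1 k hk') (hq k hk')

end IsD4Symmetric

end FractalData

/-! ### The easy basis and the formula at a vertex -/

namespace FractalData

variable {K : Type*} [MetricSpace K] [MeasurableSpace K] {S : FractalData K}
  {h : Fin 4 → K → ℝ}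

/-- The functions `P 0 l = 0` and `P (j + 1) l`, the element `f_{jl}` of the easy basis. -/
structure IsPotential (S : FractalData K) (h : Fin 4 → K → ℝ) (P : ℕ → Fin 4 → K → ℝ) : Prop where
  zero : ∀ l, P 0 l = 0
  one : ∀ l, P 1 l = h l
  continuous : ∀ j l, Continuous (P j l)
  weak : ∀ j l, S.IsWeakSolution h (P j l) (P (j - 1) l)
  apply_q : ∀ j l l', P j l (S.q l') = if j = 1 ∧ l = l' then 1 else 0

theorem IsWeakSolution.sum [CompactSpace K] [BorelSpace K] (hS : S.IsD4Symmetric)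
    (hh : S.IsHarmonicBasis h) {ι : Type*} (s : Finset ι) {u f : ι → K → ℝ}
    (hu : ∀ i, S.IsWeakSolution h (u i) (f i)) (hf : ∀ i, Continuous (f i)) :
    S.IsWeakSolution h (∑ i ∈ s, u i) (∑ i ∈ s, f i) ∧ Continuous (∑ i ∈ s, f i) := by
  classical
  induction s using Finset.induction_on with
  | empty =>
    refine ⟨?_, continuous_zero⟩
    simpa using IsWeakSolution.of_harmonic hh 0
  | insert a s ha ih =>
    rw [Finset.sum_insert ha, Finset.sum_insert ha]
    exact ⟨(hu a).add hS hh ih.1 (hf a) ih.2, (hf a).add ih.2⟩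

/-- The multiharmonic function with given boundary values of the iterated Laplacians, and its
iterated Laplacians. -/
noncomputable def chainOf (P : ℕ → Fin 4 → K → ℝ) (n : ℕ) (A : ℕ → Fin 4 → ℝ) (i : ℕ) : K → ℝ :=
  ∑ z ∈ Finset.range (n + 1) ×ˢ (Finset.univ : Finset (Fin 4)), A z.1 z.2 • P (z.1 + 1 - i) z.2

namespace IsD4Symmetric

variable [CompactSpace K] [ConnectedSpace K] [BorelSpace K]

theorem exists_potential (hS : S.IsD4Symmetric) (hh : S.IsHarmonicBasis h) :
    ∃ P, S.IsPotential h P := by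
  obtain ⟨G, hGq, hG⟩ := hS.exists_weakSolution hh
  let E : ℕ → Fin 4 → C(K, ℝ) := fun j l => Nat.rec ⟨h l, hh.continuous l⟩ (fun _ u => G u) j
  -- The index is shifted by one so that truncated subtraction lets `Δ` act as `j ↦ j - 1`, with the
  -- zero function absorbing all further applications.
  let P : ℕ → Fin 4 → K → ℝ := fun j l => Nat.casesOn j 0 fun j => E j l
  refine ⟨P, fun l => rfl, fun l => rfl, fun j l => ?_, fun j l => ?_, fun j l l' => ?_⟩
  · rcases j with _ | j
    · exact continuous_zero
    · exact (E j l).continuous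
  · rcases j with _ | _ | j
    · change S.IsWeakSolution h 0 0
      simpa using IsWeakSolution.of_harmonic hh 0
    · exact IsWeakSolution.basis hh l
    · exact hG (E j l)
  · rcases j with _ | _ | j
    · simp [P]
    · simpa [P, E] using hh.apply_q l l'
    · simpa [P, E] using hGq (E j l) l'

omit [ConnectedSpace K] in
theorem weak_chainOf (hS : S.IsD4Symmetric) (hh : S.IsHarmonicBasis h)
    {P : ℕ → Fin 4 → K → ℝ} (hP : S.IsPotential h P) (n : ℕ) (A : ℕ → Fin 4 → ℝ) (i : ℕ) :
    S.IsWeakSolution h (chainOf P n A i) (chainOf P n A (i + 1)) ∧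
      Continuous (chainOf P n A (i + 1)) :=
  IsWeakSolution.sum hS hh _ (fun z => (hP.weak (z.1 + 1 - i) z.2).smul _)
    fun z => (hP.continuous _ z.2).const_smul (A z.1 z.2)

omit [MetricSpace K] [CompactSpace K] [ConnectedSpace K] [BorelSpace K] [MeasurableSpace K] in
theorem continuous_chainOf [TopologicalSpace K] {P : ℕ → Fin 4 → K → ℝ}
    (hP : ∀ j l, Continuous (P j l)) (n : ℕ) (A : ℕ → Fin 4 → ℝ) (i : ℕ) :
    Continuous (chainOf P n A i) := by
  have e : chainOf P n A i = fun x => ∑ z ∈ Finset.range (n + 1) ×ˢ (Finset.univ : Finset (Fin 4)),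
      A z.1 z.2 * P (z.1 + 1 - i) z.2 x := by
    funext x; simp [chainOf]
  rw [e]
  exact continuous_finsetSum _ fun z _ => continuous_const.mul (hP _ _)

theorem isMultiharmonicChain_chainOf (hS : S.IsD4Symmetric) (hh : S.IsHarmonicBasis h)
    {P : ℕ → Fin 4 → K → ℝ} (hP : S.IsPotential h P) (n : ℕ) (A : ℕ → Fin 4 → ℝ) :
    S.IsMultiharmonicChain n (chainOf P n A) := by
  refine ⟨fun i _ => hS.hasLaplacian hh (continuous_chainOf hP.continuous n A i)
    (hS.weak_chainOf hh hP n A i).2 (hS.weak_chainOf hh hP n A i).1, ?_⟩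
  refine Finset.sum_eq_zero fun z hz => ?_
  have hz1 := Finset.mem_range.1 (Finset.mem_product.1 hz).1
  rw [show z.1 + 1 - (n + 1) = 0 by omega, hP.zero, smul_zero]

omit [CompactSpace K] [ConnectedSpace K] [BorelSpace K] in
theorem chainOf_apply_q {P : ℕ → Fin 4 → K → ℝ} (hP : S.IsPotential h P) {n i : ℕ} (hi : i ≤ n)
    (A : ℕ → Fin 4 → ℝ) (l : Fin 4) : chainOf P n A i (S.q l) = A i l := by
  simp only [chainOf, Finset.sum_apply, Pi.smul_apply, smul_eq_mul, hP.apply_q]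
  rw [Finset.sum_eq_single (i, l)]
  · simp
  · rintro ⟨j, l'⟩ _ hne
    rw [if_neg, mul_zero]
    rintro ⟨hj, rfl⟩
    exact hne (by simp only [Prod.mk.injEq, and_true] at hj ⊢; omega)
  · intro hn
    exact absurd (Finset.mem_product.2 ⟨Finset.mem_range.2 (by omega), Finset.mem_univ l⟩) hn

theorem chain_eq_chainOf (hS : S.IsD4Symmetric) (hh : S.IsHarmonicBasis h)
    {P : ℕ → Fin 4 → K → ℝ} (hP : S.IsPotential h P) {n : ℕ} {D : ℕ → K → ℝ}
    (hD : S.IsMultiharmonicChain n D) {i : ℕ} (hi : i ≤ n) :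
    D i = chainOf P n (fun j l => D j (S.q l)) i :=
  hS.chain_unique hD (hS.isMultiharmonicChain_chainOf hh hP n _)
    (fun _ hi l => (chainOf_apply_q hP hi (fun j l => D j (S.q l)) l).symm) (hi.trans n.le_succ)

theorem isEasyBasis_potential (hS : S.IsD4Symmetric) (hh : S.IsHarmonicBasis h)
    {P : ℕ → Fin 4 → K → ℝ} (hP : S.IsPotential h P) :
    S.IsEasyBasis fun j l => P (j + 1) l := by
  intro j l
  refine ⟨fun i => P (j + 1 - i) l, rfl, ⟨fun i _ => ?_, by simp [hP.zero]⟩, fun i hi l' => ?_⟩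
  · exact hS.hasLaplacian hh (hP.continuous _ l) (hP.continuous _ l) (hP.weak (j + 1 - i) l)
  · change P (j + 1 - i) l (S.q l') = _
    rw [hP.apply_q]
    have e : j + 1 - i = 1 ↔ i = j := by omega
    simp only [e]

theorem easyBasis_unique (hS : S.IsD4Symmetric) {f f' : ℕ → Fin 4 → K → ℝ}
    (hf : S.IsEasyBasis f) (hf' : S.IsEasyBasis f') : f = f' := by
  funext j l
  obtain ⟨D, hD0, hD, hDq⟩ := hf j l
  obtain ⟨D', hD0', hD', hDq'⟩ := hf' j l
  rw [← hD0, ← hD0']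
  exact hS.chain_unique hD hD' (fun i hi l' => by rw [hDq i hi, hDq' i hi]) (Nat.zero_le _)

/-- The normal derivatives of the easy basis depend only on whether the two boundary points
coincide. -/
theorem exists_normalDeriv_potential (hS : S.IsD4Symmetric) (hh : S.IsHarmonicBasis h)
    {P : ℕ → Fin 4 → K → ℝ} (hP : S.IsPotential h P) :
    ∃ a b : ℕ → ℝ, (∀ j l, S.HasNormalDeriv (P (j + 1) l) l (a j)) ∧
      (∀ j l l', l' ≠ l → S.HasNormalDeriv (P (j + 1) l) l' (b j)) ∧ a 0 = 3 ∧ b 0 = -1 := by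
  let M : ℕ → Fin 4 → Fin 4 → ℝ := fun j l l' => 4 * P (j + 1) l (S.q l') -
    ∑ i, P (j + 1) l (S.q i) + ∫ x, h l' x * P j l x ∂S.μ
  have hM : ∀ j l l', S.HasNormalDeriv (P (j + 1) l) l' (M j l l') := fun j l l' =>
    hS.hasNormalDeriv hh (hP.weak (j + 1) l) (hP.continuous j l) l'
  -- Permutations are transitive on points and on ordered pairs of distinct points, so invariance
  -- leaves one diagonal and one off-diagonal entry for each `j`.
  have hsymm : ∀ (σ : Equiv.Perm (Fin 4)) j l l', M j (σ l) (σ l') = M j l l' := by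
    intro σ j l l'
    obtain ⟨g, hg, hgE, hgμ⟩ := hS.symmetric σ
    have hPg : ∀ j l, P j l = P j (σ l) ∘ g := by
      intro j
      induction j with
      | zero => intro l; rw [hP.zero, hP.zero]; rfl
      | succ j ih =>
        intro l
        have h2 := hP.weak (j + 1) l
        rw [Nat.add_sub_cancel, ih l] at h2
        exact hS.weakSolution_comp hh hg hgE hgμ (hP.continuous _ _) (hP.continuous _ _)
          (hP.continuous j _) (hP.weak (j + 1) (σ l)) h2 fun i => by simp [hP.apply_q]
    have hI : ∫ x, h l' x * P j l x ∂S.μ = ∫ x, h (σ l') x * P j (σ l) x ∂S.μ := by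
      rw [hPg j l, hS.harmonicBasis_comp hh hg hgE hgμ l']
      exact integral_comp_homeomorph hgμ ((hh.continuous (σ l')).mul (hP.continuous j (σ l)))
    have hsum : ∑ i, P (j + 1) (σ l) (S.q i) = ∑ i, P (j + 1) l (S.q i) := by
      rw [← Equiv.sum_comp σ]
      simp [hP.apply_q]
    simp only [M, hI, hsum]
    simp [hP.apply_q]
  have e1 : ∀ l : Fin 4, ∃ σ : Equiv.Perm (Fin 4), σ 0 = l := fun l =>
    ⟨Equiv.swap 0 l, Equiv.swap_apply_left 0 l⟩
  have e2 : ∀ l l' : Fin 4, l' ≠ l → ∃ σ : Equiv.Perm (Fin 4), σ 0 = l ∧ σ 1 = l' := by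
    decide
  refine ⟨fun j => M j 0 0, fun j => M j 0 1, fun j l => ?_, fun j l l' hl => ?_, ?_, ?_⟩
  · obtain ⟨σ, rfl⟩ := e1 l
    have := hM j (σ 0) (σ 0)
    rwa [hsymm] at this
  · obtain ⟨σ, rfl, rfl⟩ := e2 l l' hl
    have := hM j (σ 0) (σ 1)
    rwa [hsymm] at this
  · simp only [M, Fin.sum_univ_four, hP.apply_q, hP.zero]
    norm_num [Fin.ext_iff]
  · simp only [M, Fin.sum_univ_four, hP.apply_q, hP.zero]
    norm_num [Fin.ext_iff]

/-- The normal derivatives of a multiharmonic function and of its iterated Laplacians. -/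
theorem hasNormalDeriv_chain (hS : S.IsD4Symmetric) (hh : S.IsHarmonicBasis h)
    {P : ℕ → Fin 4 → K → ℝ} (hP : S.IsPotential h P) {a b : ℕ → ℝ}
    (ha : ∀ j l, S.HasNormalDeriv (P (j + 1) l) l (a j))
    (hb : ∀ j l l', l' ≠ l → S.HasNormalDeriv (P (j + 1) l) l' (b j)) {n : ℕ} {D : ℕ → K → ℝ}
    (hD : S.IsMultiharmonicChain n D) {i N : ℕ} (hi : i + N = n) (l : Fin 4) :
    S.HasNormalDeriv (D i) l (∑ t ∈ Finset.range (N + 1), (a t * D (i + t) (S.q l) +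
      b t * ∑ l' ∈ Finset.univ.erase l, D (i + t) (S.q l'))) := by
  have e1 : D i = ∑ t ∈ Finset.range (N + 1), ∑ l', D (i + t) (S.q l') • P (t + 1) l' := by
    rw [hS.chain_eq_chainOf hh hP hD (show i ≤ n by omega), chainOf, Finset.sum_product,
      show n + 1 = i + (N + 1) by omega, Finset.sum_range_add, Finset.sum_eq_zero, zero_add]
    · refine Finset.sum_congr rfl fun t _ => ?_
      simp only [show i + t + 1 - i = t + 1 by omega]
    · intro j hj
      have := Finset.mem_range.1 hj
      refine Finset.sum_eq_zero fun l' _ => ?_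
      rw [show j + 1 - i = 0 by omega, hP.zero, smul_zero]
  rw [e1]
  refine HasNormalDeriv.sum _ fun t _ => ?_
  have e2 : a t * D (i + t) (S.q l) + b t * ∑ l' ∈ Finset.univ.erase l, D (i + t) (S.q l') =
      ∑ l', D (i + t) (S.q l') * if l' = l then a t else b t := by
    rw [← Finset.add_sum_erase _ _ (Finset.mem_univ l), if_pos rfl, Finset.mul_sum, mul_comm]
    congr 1
    refine Finset.sum_congr rfl fun l' hl' => ?_
    rw [if_neg (Finset.ne_of_mem_erase hl'), mul_comm]
  rw [e2]
  refine HasNormalDeriv.sum _ fun l' _ => HasNormalDeriv.smul ?_ _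
  split_ifs with hl
  · exact hl ▸ ha t l'
  · exact hb t l' l fun e => hl e.symm

/-- The renormalized graph Laplacian of a multiharmonic function on the neighborhood of a
vertex. -/
theorem renormLaplacian_local (hS : S.IsD4Symmetric) (hh : S.IsHarmonicBasis h)
    {P : ℕ → Fin 4 → K → ℝ} (hP : S.IsPotential h P) {a b c : ℕ → ℝ}
    (ha : ∀ j l, S.HasNormalDeriv (P (j + 1) l) l (a j))
    (hb : ∀ j l l', l' ≠ l → S.HasNormalDeriv (P (j + 1) l) l' (b j))
    (ha0 : a 0 = 3) (hb0 : b 0 = -1) (hc0 : c 0 = 1)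
    (hc : ∀ j ≥ 1, c j = 1 / 3 * a j + ∑ s ∈ Finset.range j, b (j - s) * c s)
    {n m : ℕ} {x : K} (hx : x ∈ S.V m) {u : K → ℝ} {A : ℕ → ℝ}
    (hu : S.IsLocalMultiharmonic n m x u A) :
    S.renormLaplacian m u x =
      12 * ∑ j ∈ Finset.Icc 1 n, S.ρ ^ (m * (j - 1)) * c j * A j := by
  classical
  obtain ⟨D, hD0, hDc, hDA, hDm⟩ := hu
  have hρ := hS.rho_pos
  have hrange : ∀ {w : S.Word m} {l}, S.cellMap m w (S.q l) = x →
      x ∈ Set.range (S.cellMap m w) := fun {w l} e => ⟨S.q l, e⟩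
  -- The linear functional of the matching condition. Applied to the constant 1, to neighbour sums
  -- and to normal derivatives, it reduces the problem to scalar sequences.
  let C : (S.Word m → Fin 4 → ℝ) → ℝ := fun g =>
    ∑ w, ∑ l, if S.cellMap m w (S.q l) = x then (S.rWord w)⁻¹ * g w l else 0
  have hC : ∀ g g' : S.Word m → Fin 4 → ℝ,
      (∀ w l, S.cellMap m w (S.q l) = x → g w l = g' w l) → C g = C g' := fun g g' e =>
    Finset.sum_congr rfl fun w _ => Finset.sum_congr rfl fun l _ => by
      split_ifs with hwl
      · rw [e w l hwl]
      · rfl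
  have hClin : ∀ (s t : ℝ) (g g' : S.Word m → Fin 4 → ℝ),
      C (fun w l => s * g w l + t * g' w l) = s * C g + t * C g' := by
    intro s t g g'
    simp only [C, Finset.mul_sum, ← Finset.sum_add_distrib]
    refine Finset.sum_congr rfl fun w _ => Finset.sum_congr rfl fun l _ => ?_
    split_ifs <;> ring
  have hCsum : ∀ (N : ℕ) (g : ℕ → S.Word m → Fin 4 → ℝ),
      C (fun w l => ∑ t ∈ Finset.range N, g t w l) = ∑ t ∈ Finset.range N, C (g t) := by
    intro N g
    induction N with
    | zero => simp [C]
    | succ N ih =>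
      simp only [Finset.sum_range_succ, ← ih]
      simpa using hClin 1 1 (fun w l => ∑ t ∈ Finset.range N, g t w l) (g N)
  let T : ℕ → S.Word m → Fin 4 → ℝ := fun j w l =>
    ∑ l' ∈ Finset.univ.erase l, D j w (S.q l')
  set R := C fun _ _ => 1
  have hmatch : ∀ N i, i + N = n → ∑ t ∈ Finset.range (N + 1),
      (a t * (S.ρ ^ (m * (i + t)) * (R * A (i + t))) +
        b t * (S.ρ ^ (m * (i + t)) * C (T (i + t)))) = 0 := by
    intro N i hi
    obtain ⟨d, hd, hsum⟩ := hDm i (by omega)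
    have hd' : ∀ w l, S.cellMap m w (S.q l) = x → S.ρ ^ (m * i) * d w l =
        ∑ t ∈ Finset.range (N + 1), (a t * S.ρ ^ (m * (i + t)) * A (i + t) * 1 +
          b t * S.ρ ^ (m * (i + t)) * T (i + t) w l) := by
      intro w l hwl
      have h1 := hS.hasNormalDeriv_chain hh hP ha hb (hDc w (hrange hwl)) hi l
      -- The chain on the cell consists of the rescaled functions, so the given derivative is
      -- multiplied by `(r_w μ_w)^i = ρ^{mi}` before uniqueness of limits is used.
      have h2 := (hd w l hwl).smul ((S.rWord w * S.pWord w) ^ i)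
      have h3 := tendsto_nhds_unique h2 h1
      rw [hS.rWord_mul_pWord, ← pow_mul] at h3
      rw [h3]
      refine Finset.sum_congr rfl fun t ht => ?_
      have ht' := Finset.mem_range.1 ht
      rw [← pow_mul, hDA (i + t) (by omega) w l hwl, ← Finset.mul_sum]
      ring
    have h1 : C (fun w l => S.ρ ^ (m * i) * d w l) = 0 := by
      have := hClin (S.ρ ^ (m * i)) 0 d d
      simp only [zero_mul, add_zero] at this
      rw [this, show C d = 0 from hsum, mul_zero]
    rw [hC _ _ hd', hCsum] at h1
    rw [← h1]
    refine Finset.sum_congr rfl fun t _ => ?_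
    rw [hClin]
    ring
  have hsol := solve_matching ha0 hb0 hc0 hc
    (α := fun j => S.ρ ^ (m * j) * (R * A j)) (β := fun j => S.ρ ^ (m * j) * C (T j))
    hmatch n 0 (zero_add n)
  simp only [mul_zero, pow_zero, one_mul, zero_add] at hsol
  rw [Finset.sum_range_succ', hc0] at hsol
  simp only [mul_zero, pow_zero, one_mul] at hsol
  -- The subtracted term is the summand of index 0 in `hsol`, where `c 0 = 1`; hence no term in `A
  -- 0` survives.
  have hlap : S.graphLaplacian m u x = C (T 0) - 3 * (R * A 0) := by
    have h1 := hClin 1 (-3 * A 0) (T 0) fun _ _ => 1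
    rw [graphLaplacian_eq]
    have h2 : C (T 0) - 3 * (R * A 0) = C fun w l => 1 * T 0 w l + -3 * A 0 * 1 := by
      rw [h1]; ring
    rw [h2]
    refine Finset.sum_congr rfl fun w _ => Finset.sum_congr rfl fun l _ => ?_
    split_ifs with hwl
    · congr 1
      have h3 : ∀ j, u (S.cellMap m w (S.q j)) = D 0 w (S.q j) := fun j =>
        (congrFun (hD0 w (hrange hwl)) (S.q j)).symm
      have h4 := Finset.add_sum_erase Finset.univ (fun j => D 0 w (S.q j)) (Finset.mem_univ l)
      simp only [h3, T]
      rw [← h4, hDA 0 n.zero_le w l hwl]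
      ring
    · rfl
  have hRpos : 0 < R := by
    simpa [R, C] using sum_corner_pos hx (g := fun w => (S.rWord w)⁻¹)
      fun w => inv_pos.2 (hS.rWord_pos w)
  -- As `μ_w = ρ^m r_w⁻¹`, the tent integral contains the same sum `R`, which cancels, while `ρ^m`
  -- lowers the exponent of `ρ` by `m`.
  have htent : ∫ y, S.tent m x y ∂S.μ = 1 / 4 * (S.ρ ^ m * R) := by
    rw [hS.integral_tent hh hx]
    simp only [R, C, Finset.mul_sum, mul_ite, mul_zero, mul_one, hS.pWord_eq]
  rw [renormLaplacian, htent, hlap, hsol]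
  have hIcc : ∑ j ∈ Finset.Icc 1 n, S.ρ ^ (m * (j - 1)) * c j * A j =
      ∑ t ∈ Finset.range n, S.ρ ^ (m * t) * c (t + 1) * A (t + 1) := by
    rw [← Finset.Ico_add_one_right_eq_Icc, Finset.sum_Ico_eq_sum_range]
    refine Finset.sum_congr (by simp) fun t _ => ?_
    rw [add_comm 1 t, Nat.add_sub_cancel]
  have hfac : ∑ t ∈ Finset.range n, c (t + 1) * (S.ρ ^ (m * (t + 1)) * (R * A (t + 1))) =
      S.ρ ^ m * R * ∑ t ∈ Finset.range n, S.ρ ^ (m * t) * c (t + 1) * A (t + 1) := by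
    rw [Finset.mul_sum]
    refine Finset.sum_congr rfl fun t _ => ?_
    rw [mul_add, mul_one, pow_add]
    ring
  rw [hIcc, hfac]
  have hρm : S.ρ ^ m ≠ 0 := (pow_pos hρ m).ne'
  field_simp
  ring

end IsD4Symmetric

end FractalData

theorem lemma6p3 {K : Type*} [MetricSpace K] [CompactSpace K] [ConnectedSpace K]
    [MeasurableSpace K] [BorelSpace K] (S : FractalData K) (hS : S.IsD4Symmetric) :
    (∃! f : ℕ → Fin 4 → K → ℝ, S.IsEasyBasis f) ∧
    ∀ f : ℕ → Fin 4 → K → ℝ, S.IsEasyBasis f →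
      ∃ a b : ℕ → ℝ,
        (∀ j l, S.HasNormalDeriv (f j l) l (a j)) ∧
        (∀ j l l', l' ≠ l → S.HasNormalDeriv (f j l) l' (b j)) ∧
        a 0 = 3 ∧ b 0 = -1 ∧
        ∀ c : ℕ → ℝ, c 0 = 1 →
          (∀ j ≥ 1, c j = 1 / 3 * a j + ∑ s ∈ Finset.range j, b (j - s) * c s) →
          ∀ (n m : ℕ) (x : K), x ∈ S.V m → x ∉ S.V 0 →
            ∀ (h : K → ℝ) (A : ℕ → ℝ), S.IsLocalMultiharmonic n m x h A →
              S.renormLaplacian m h x =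
                12 * ∑ j ∈ Finset.Icc 1 n, S.ρ ^ (m * (j - 1)) * c j * A j := by
  obtain ⟨h, hh⟩ := hS.exists_harmonicBasis
  obtain ⟨P, hP⟩ := hS.exists_potential hh
  have hbasis := hS.isEasyBasis_potential hh hP
  refine ⟨⟨_, hbasis, fun f hf => hS.easyBasis_unique hf hbasis⟩, fun f hf => ?_⟩
  obtain rfl := hS.easyBasis_unique hf hbasis
  obtain ⟨a, b, ha, hb, ha0, hb0⟩ := hS.exists_normalDeriv_potential hh hP
  exact ⟨a, b, ha, hb, ha0, hb0, fun c hc0 hc n m x hx _ u A hu =>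
    hS.renormLaplacian_local hh hP ha hb ha0 hb0 hc0 hc hx hu⟩
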